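/- Let $B$ be a path-connected finite CW complex of dimension at most $2$, let $p:E\to B$ be a fibre bundle (a continuous map that is locally trivial with some typical fibre, an arbitrary topological space), and let $*_B\in B$ and $*_E\in E$ be base points with $p(*_E)=*_B$. Write $F=p^{-1}(*_B)$. (a) Suppose that $E$ is path-connected. Then there is a continuous map $s:B\to E$ with $p\circ s=\mathrm{id}_B$ if and only if the inclusion of $F$ into $E$ induces a monomorphism $\pi_1(F,*_E)\to\pi_1(E,*_E)$ and there is a homomorphism $\mathfrak{s}:\pi_1(B,*_B)\to\pi_1(E,*_E)$ such that $p_*\circ\mathfrak{s}=\mathrm{id}_{\pi_1(B,*_B)}$. (b) Whether or not $E$ is path-connected, if $\pi_1(F,*_E)\to\pi_1(E,*_E)$ is injective and $\mathfrak{s}:\pi_1(B,*_B)\to\pi_1(E,*_E)$ is any homomorphism with $p_*\circ\mathfrak{s}=\mathrm{id}_{\pi_1(B,*_B)}$, then there is a continuous map $s:B\to E$ with $p\circ s=\mathrm{id}_B$, $s(*_B)=*_E$ and $s_*=\mathfrak{s}$. -/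

import Mathlib

open Topology

/-- `p : E → B` is a fibre bundle with typical fibre `F`: every point of the base lies in the base
set of a local trivialization `p ⁻¹ U ≃ₜ U × F` over an open set `U`. -/
def IsFibreBundle {E B : Type*} (F : Type*) [TopologicalSpace E] [TopologicalSpace B]
    [TopologicalSpace F] (p : E → B) : Prop :=
  ∀ x : B, ∃ t : Bundle.Trivialization F p, x ∈ t.baseSet

/-- A (Hausdorff) space `B` with a CW structure is a finite `2`-complex: it has finitely many
cells, all of dimension at most `2`. -/
structure IsFinite2Complex (B : Type*) [TopologicalSpace B] [CWComplex (Set.univ : Set B)] :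
    Prop where
  finite : CWComplex.Finite (Set.univ : Set B)
  dim_le_two : ∀ n : ℕ, 2 < n → IsEmpty (RelCWComplex.cell (Set.univ : Set B) n)

/-- The inclusion into `E` of the fibre `p ⁻¹ {b}`. -/
def fibreInclusion {E B : Type*} [TopologicalSpace E] [TopologicalSpace B] (p : C(E, B)) (b : B) :
    C(p ⁻¹' {b}, E) :=
  ⟨Subtype.val, continuous_subtype_val⟩

/-! Let Λ be the image of the given splitting: a subgroup of π₁(E, e) that `p` maps isomorphically
onto π₁(B, p e). The section is built cell by cell, in order of dimension. Each value is stored with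
a marking, a path in E from e to that value, and the invariant is that for every path ω in the part
A already treated, (marking at the start) · s(ω) · (marking at the end)⁻¹ lies in Λ.

Over a 0-cell any point of the fibre joined to e will do. Over a 1-cell, surjectivity of Λ → π₁(B)
prescribes the class of a lift, and `IsFibreBundle.exists_lift_of_mk_map_eq` realises that class by
an honest lift. Over the boundary of a 2-cell the section gives a loop in a conjugate of Λ with
null-homotopic projection, so injectivity of `p` on Λ makes it null-homotopic in E. The bundle is
trivial over the cell and the fibre is π₁-injective, so the fibre coordinate of the loop is
null-homotopic too, and the section extends (`IsFibreBundle.exists_square_lift`). The invariant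
survives because path classes in the enlarged space are generated by those in A and those in the
cell (`IsCellAttachment.induction_on_path_class`). The base point need not be a vertex: when it lies
inside a cell, the extension is deformed relative to the boundary until it takes the value e there.
At the end the invariant puts s_* into Λ, and p ∘ s = id then forces it to be the given splitting.

Conversely, a section s yields a splitting by conjugating s_* with a path whose projection is
null-homotopic. If H contracts a fibre loop in E, then H and s ∘ p ∘ H are compared in a
trivialization over p ∘ H: they agree on three edges of the square, so the fourth edges are
homotopic in the fibre.

All lifting rests on the triviality of bundles over a square, which turns lifting problems into
identities in fundamental groupoids. -/

/-! ### Triviality of bundles pulled back to an interval or a square -/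

section Trivializations

open unitInterval

variable {X Y Z E B F : Type*} [TopologicalSpace X] [TopologicalSpace Y] [TopologicalSpace Z]
  [TopologicalSpace E] [TopologicalSpace B] [TopologicalSpace F]

theorem continuousOn_of_isClosed_cover {f : Y → Z} {S K₁ K₂ : Set Y} (h₁ : IsClosed K₁)
    (h₂ : IsClosed K₂) (hS : S ⊆ K₁ ∪ K₂) (hf₁ : ContinuousOn f (S ∩ K₁))
    (hf₂ : ContinuousOn f (S ∩ K₂)) : ContinuousOn f S := by
  have key : ∀ {K : Set Y}, IsClosed K → ContinuousOn f (S ∩ K) → ∀ y ∈ S,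
      ContinuousWithinAt f (S ∩ K) y := by
    intro K hK hf y hy
    by_cases hyK : y ∈ K
    · exact hf y ⟨hy, hyK⟩
    · refine continuousWithinAt_of_notMem_closure fun hc => hyK ?_
      exact hK.closure_subset (closure_mono Set.inter_subset_right hc)
  intro y hy
  have : S = (S ∩ K₁) ∪ (S ∩ K₂) := by
    rw [← Set.inter_union_distrib_left, Set.inter_eq_left.2 hS]
  rw [this, continuousWithinAt_union]
  exact ⟨key h₁ hf₁ y hy, key h₂ hf₂ y hy⟩

/-- A trivialization over `C ⊆ X` of the pullback of `p : E → B` along `ω : X → B`, given by the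
fibre coordinate `coord` and its inverse `point`. -/
structure TrivAlong (F : Type*) [TopologicalSpace F] (p : E → B) (ω : X → B) (C : Set X) where
  /-- The fibre coordinate of a point of the pullback. -/
  coord : X × E → F
  /-- The point of the pullback with the given base point and fibre coordinate. -/
  point : X × F → E
  continuousOn_coord : ContinuousOn coord {q | q.1 ∈ C ∧ p q.2 = ω q.1}
  continuousOn_point : ContinuousOn point {q | q.1 ∈ C}
  proj_point : ∀ x ∈ C, ∀ f, p (point (x, f)) = ω x
  coord_point : ∀ x ∈ C, ∀ f, coord (x, point (x, f)) = f
  point_coord : ∀ x ∈ C, ∀ z, p z = ω x → point (x, coord (x, z)) = z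

namespace TrivAlong

variable {p : E → B} {ω : X → B} {C C₁ C₂ : Set X}

/-- Restriction of a trivialization to a smaller set. -/
def mono (T : TrivAlong F p ω C₁) (h : C₂ ⊆ C₁) : TrivAlong F p ω C₂ where
  coord := T.coord
  point := T.point
  continuousOn_coord := T.continuousOn_coord.mono fun _ hq => ⟨h hq.1, hq.2⟩
  continuousOn_point := T.continuousOn_point.mono fun _ hq => h hq
  proj_point x hx := T.proj_point x (h hx)
  coord_point x hx := T.coord_point x (h hx)
  point_coord x hx := T.point_coord x (h hx)

/-- Pullback of a trivialization along a continuous map. -/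
def comp (T : TrivAlong F p ω Set.univ) (j : C(Y, X)) : TrivAlong F p (ω ∘ j) Set.univ where
  coord q := T.coord (j q.1, q.2)
  point q := T.point (j q.1, q.2)
  continuousOn_coord := T.continuousOn_coord.comp (by fun_prop) fun _ hq => ⟨trivial, hq.2⟩
  continuousOn_point := T.continuousOn_point.comp (by fun_prop) fun _ _ => trivial
  proj_point x _ := T.proj_point (j x) trivial
  coord_point x _ := T.coord_point (j x) trivial
  point_coord x _ := T.point_coord (j x) trivial

theorem continuous_coord (T : TrivAlong F p ω Set.univ) {f : Y → X} {g : Y → E}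
    (hf : Continuous f) (hg : Continuous g) (h : ∀ y, p (g y) = ω (f y)) :
    Continuous fun y => T.coord (f y, g y) :=
  T.continuousOn_coord.comp_continuous (hf.prodMk hg) fun y => ⟨trivial, h y⟩

theorem continuous_point (T : TrivAlong F p ω Set.univ) : Continuous T.point :=
  T.continuousOn_point.comp_continuous continuous_id (fun _ => trivial)

/-- A local trivialization of `p` trivializes pullbacks along maps into its base set. -/
def ofTrivialization (t : Bundle.Trivialization F p) (hω : ContinuousOn ω C)
    (hC : ∀ x ∈ C, ω x ∈ t.baseSet) : TrivAlong F p ω C where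
  coord q := (t q.2).2
  point q := t.toOpenPartialHomeomorph.symm (ω q.1, q.2)
  continuousOn_coord := by
    refine continuous_snd.comp_continuousOn
      (t.continuousOn_toFun.comp continuousOn_snd fun q hq => ?_)
    rw [t.source_eq, Set.mem_preimage, hq.2]
    exact hC _ hq.1
  continuousOn_point := by
    refine t.continuousOn_invFun.comp (f := fun q : X × F => (ω q.1, q.2))
      ((hω.comp continuousOn_fst fun q hq => hq).prodMk continuousOn_snd) fun q hq => ?_
    exact t.mem_target.2 (hC _ hq)
  proj_point x hx f := t.proj_symm_apply' (hC x hx)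
  coord_point x hx f := by rw [t.apply_symm_apply' (hC x hx)]
  point_coord x hx z hz := by
    have : z ∈ t.source := by rw [t.mem_source, hz]; exact hC x hx
    dsimp only
    rw [← hz, t.symm_apply_mk_proj this]

open Classical in
/-- Two trivializations over closed sets glue, provided that the intersection of these sets is a
retract of one of them. -/
noncomputable def glue (T₁ : TrivAlong F p ω C₁) (T₂ : TrivAlong F p ω C₂) (h₁ : IsClosed C₁)
    (h₂ : IsClosed C₂) (r : X → X) (hr : Continuous r) (hr₂ : ∀ x ∈ C₂, r x ∈ C₁ ∩ C₂)
    (hrid : ∀ x ∈ C₁ ∩ C₂, r x = x) : TrivAlong F p ω (C₁ ∪ C₂) := by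
  -- Over C₂ the coordinate of T₂ is corrected by the transition map F → F from T₂ to T₁ taken at `r
  -- x`, which is defined on all of C₂. On the intersection `r x = x`, so the result agrees with T₁
  -- there; `ψ'` uses the inverse transition map.
  let φ' : X × E → F := fun q => T₁.coord (r q.1, T₂.point (r q.1, T₂.coord q))
  let ψ' : X × F → E := fun q => T₂.point (q.1, T₂.coord (r q.1, T₁.point (r q.1, q.2)))
  have hφ' : ContinuousOn φ' {q | q.1 ∈ C₂ ∧ p q.2 = ω q.1} := by
    refine T₁.continuousOn_coord.comp ((hr.comp continuous_fst).continuousOn.prodMk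
      (T₂.continuousOn_point.comp ((hr.comp continuous_fst).continuousOn.prodMk
        T₂.continuousOn_coord) fun q hq => (hr₂ _ hq.1).2)) fun q hq => ⟨(hr₂ _ hq.1).1, ?_⟩
    exact T₂.proj_point _ (hr₂ _ hq.1).2 _
  have hψ' : ContinuousOn ψ' {q | q.1 ∈ C₂} := by
    refine T₂.continuousOn_point.comp (continuousOn_fst.prodMk
      (T₂.continuousOn_coord.comp ((hr.comp continuous_fst).continuousOn.prodMk
        (T₁.continuousOn_point.comp ((hr.comp continuous_fst).continuousOn.prodMk
          continuousOn_snd) fun q hq => (hr₂ _ hq).1)) fun q hq => ⟨(hr₂ _ hq).2, ?_⟩))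
        fun q hq => hq
    exact T₁.proj_point _ (hr₂ _ hq).1 _
  have eφ : ∀ x ∈ C₁, x ∈ C₂ → ∀ z, p z = ω x → φ' (x, z) = T₁.coord (x, z) := by
    intro x hx hx' z hz
    simp only [φ', hrid x ⟨hx, hx'⟩, T₂.point_coord x hx' z hz]
  have eψ : ∀ x ∈ C₁, x ∈ C₂ → ∀ f, ψ' (x, f) = T₁.point (x, f) := by
    intro x hx hx' f
    simp only [ψ', hrid x ⟨hx, hx'⟩]
    exact T₂.point_coord x hx' _ (T₁.proj_point x hx f)
  have of_mem : ∀ {x}, x ∈ C₁ ∪ C₂ → x ∉ C₁ → x ∈ C₂ := fun h h' => h.resolve_left h'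
  exact
  { coord := fun q => if q.1 ∈ C₁ then T₁.coord q else φ' q
    point := fun q => if q.1 ∈ C₁ then T₁.point q else ψ' q
    continuousOn_coord := by
      refine continuousOn_of_isClosed_cover (h₁.preimage continuous_fst)
        (h₂.preimage continuous_fst) (fun q hq => hq.1) ?_ ?_
      · refine (T₁.continuousOn_coord.mono fun q hq => ⟨hq.2, hq.1.2⟩).congr fun q hq => ?_
        exact if_pos hq.2
      · refine (hφ'.mono fun q hq => ⟨hq.2, hq.1.2⟩).congr fun q hq => ?_
        split_ifs with h
        · exact (eφ q.1 h hq.2 q.2 hq.1.2).symm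
        · rfl
    continuousOn_point := by
      refine continuousOn_of_isClosed_cover (h₁.preimage continuous_fst)
        (h₂.preimage continuous_fst) (fun q hq => hq) ?_ ?_
      · refine (T₁.continuousOn_point.mono fun q hq => hq.2).congr fun q hq => ?_
        exact if_pos hq.2
      · refine (hψ'.mono fun q hq => hq.2).congr fun q hq => ?_
        split_ifs with h
        · exact (eψ q.1 h hq.2 q.2).symm
        · rfl
    proj_point := by
      intro x hx f
      dsimp only
      split_ifs with h
      · exact T₁.proj_point x h f
      · exact T₂.proj_point x (of_mem hx h) _
    coord_point := by
      intro x hx f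
      dsimp only
      split_ifs with h
      · exact T₁.coord_point x h f
      · have hx₂ := of_mem hx h
        simp only [φ', ψ']
        rw [T₂.coord_point x hx₂,
          T₂.point_coord _ (hr₂ x hx₂).2 _ (T₁.proj_point _ (hr₂ x hx₂).1 _),
          T₁.coord_point _ (hr₂ x hx₂).1]
    point_coord := by
      intro x hx z hz
      dsimp only
      split_ifs with h
      · exact T₁.point_coord x h z hz
      · have hx₂ := of_mem hx h
        simp only [φ', ψ']
        rw [T₁.point_coord _ (hr₂ x hx₂).1 _ (T₂.proj_point _ (hr₂ x hx₂).2 _),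
          T₂.coord_point _ (hr₂ x hx₂).2, T₂.point_coord x hx₂ z hz] }

end TrivAlong

/-- A Lebesgue subdivision makes the bundle trivial on each small rectangle. Rectangles are glued
into strips and strips into the square; each new piece meets the old ones in one edge, onto which it
projects. -/
theorem exists_trivAlong_square {p : E → B} (hp : IsFibreBundle F p) (ω : C(I × I, B)) :
    Nonempty (TrivAlong F p ω Set.univ) := by
  choose t ht using hp
  obtain ⟨a, ha0, hamono, ⟨N, hN⟩, ha⟩ :=
    exists_monotone_Icc_subset_open_cover_unitInterval_prod_self
    (c := fun x : B => ω ⁻¹' (t x).baseSet)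
    (fun x => (t x).open_baseSet.preimage ω.continuous)
    (fun q _ => Set.mem_iUnion.2 ⟨ω q, ht _⟩)
  have hcell : ∀ n m, Nonempty (TrivAlong F p ω
      (Set.Icc (a n) (a (n + 1)) ×ˢ Set.Icc (a m) (a (m + 1)))) := by
    intro n m
    obtain ⟨x, hx⟩ := ha n m
    exact ⟨.ofTrivialization (t x) ω.continuous.continuousOn fun q hq => hx hq⟩
  have hrow : ∀ n m, Nonempty (TrivAlong F p ω
      (Set.Icc (a n) (a (n + 1)) ×ˢ Set.Icc 0 (a m))) := by
    intro n m
    induction m with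
    | zero =>
      obtain ⟨T⟩ := hcell n 0
      refine ⟨T.mono (Set.prod_mono le_rfl ?_)⟩
      rw [ha0]
      exact Set.Icc_subset_Icc le_rfl bot_le
    | succ m ih =>
      obtain ⟨T₁⟩ := ih
      obtain ⟨T₂⟩ := hcell n m
      have h := hamono m.le_succ
      refine ⟨(T₁.glue T₂ (isClosed_Icc.prod isClosed_Icc) (isClosed_Icc.prod isClosed_Icc)
        (fun q => (q.1, a m)) (by fun_prop) ?_ ?_).mono ?_⟩
      · rintro ⟨x, y⟩ ⟨hx, hy⟩
        exact ⟨⟨hx, bot_le, le_rfl⟩, ⟨hx, le_rfl, h⟩⟩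
      · rintro ⟨x, y⟩ ⟨⟨hx, hy⟩, ⟨hx', hy'⟩⟩
        exact Prod.ext rfl (le_antisymm hy'.1 hy.2)
      · rintro ⟨x, y⟩ ⟨hx, hy⟩
        rcases le_total y (a m) with h' | h'
        · exact Or.inl ⟨hx, hy.1, h'⟩
        · exact Or.inr ⟨hx, h', hy.2⟩
  have hcol : ∀ n, Nonempty (TrivAlong F p ω (Set.Icc 0 (a n) ×ˢ Set.Icc 0 1)) := by
    intro n
    induction n with
    | zero =>
      obtain ⟨T⟩ := hrow 0 N
      refine ⟨T.mono (Set.prod_mono ?_ ?_)⟩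
      · rw [ha0]
        exact Set.Icc_subset_Icc le_rfl bot_le
      · rw [hN N le_rfl]
    | succ n ih =>
      obtain ⟨T₁⟩ := ih
      obtain ⟨T₂⟩ := hrow n N
      have h := hamono n.le_succ
      refine ⟨(T₁.glue T₂ (isClosed_Icc.prod isClosed_Icc) (isClosed_Icc.prod isClosed_Icc)
        (fun q => (a n, q.2)) (by fun_prop) ?_ ?_).mono ?_⟩
      · rintro ⟨x, y⟩ ⟨hx, hy⟩
        exact ⟨⟨⟨bot_le, le_rfl⟩, bot_le, le_top⟩, ⟨⟨le_rfl, h⟩, hy⟩⟩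
      · rintro ⟨x, y⟩ ⟨⟨hx, hy⟩, ⟨hx', hy'⟩⟩
        exact Prod.ext (le_antisymm hx'.1 hx.2) rfl
      · rintro ⟨x, y⟩ ⟨hx, hy⟩
        rcases le_total x (a n) with h' | h'
        · exact Or.inl ⟨⟨hx.1, h'⟩, hy⟩
        · exact Or.inr ⟨⟨h', hx.2⟩, by rw [hN N le_rfl]; exact hy⟩
  obtain ⟨T⟩ := hcol N
  refine ⟨T.mono ?_⟩
  rintro ⟨x, y⟩ -
  rw [hN N le_rfl]
  exact ⟨⟨bot_le, le_top⟩, bot_le, le_top⟩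

theorem exists_trivAlong_of_retract {p : E → B} (hp : IsFibreBundle F p) (ω : C(X, B))
    (j : C(X, I × I)) (r : C(I × I, X)) (hrj : ∀ x, r (j x) = x) :
    Nonempty (TrivAlong F p ω Set.univ) := by
  obtain ⟨T⟩ := exists_trivAlong_square hp (ω.comp r)
  have : ω = ((ω.comp r : C(I × I, B)) : I × I → B) ∘ j := funext fun x => by simp [hrj]
  rw [this]
  exact ⟨T.comp j⟩

theorem exists_trivAlong_interval {p : E → B} (hp : IsFibreBundle F p) (ω : C(I, B)) :
    Nonempty (TrivAlong F p ω Set.univ) :=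
  exists_trivAlong_of_retract hp ω ⟨fun t => (t, 0), by fun_prop⟩ ⟨Prod.fst, by fun_prop⟩
    fun _ => rfl

end Trivializations

/-! ### Singular squares and commutative squares in the fundamental groupoid -/

section Squares

open unitInterval

variable {Y : Type*} [TopologicalSpace Y]

/-- The boundary of a singular square commutes in the fundamental groupoid. -/
theorem Path.Homotopic.Quotient.mk_trans_eq_of_square {a b c d : Y} (K : C(I × I, Y))
    (bot : Path a b) (right : Path b c) (left : Path a d) (top : Path d c)
    (hb : ∀ s, K (s, 0) = bot s) (hr : ∀ t, K (1, t) = right t)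
    (hl : ∀ t, K (0, t) = left t) (ht : ∀ s, K (s, 1) = top s) :
    (mk bot).trans (mk right) = (mk left).trans (mk top) := by
  obtain rfl : K (0, 0) = a := by rw [hb, bot.source]
  obtain rfl : K (1, 0) = b := by rw [hb, bot.target]
  obtain rfl : K (0, 1) = d := by rw [ht, top.source]
  obtain rfl : K (1, 1) = c := by rw [ht, top.target]
  let β : Path ((0, 0) : I × I) (1, 0) := ⟨⟨fun s => (s, 0), by fun_prop⟩, rfl, rfl⟩
  let ρ : Path ((1, 0) : I × I) (1, 1) := ⟨⟨fun t => (1, t), by fun_prop⟩, rfl, rfl⟩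
  let l : Path ((0, 0) : I × I) (0, 1) := ⟨⟨fun t => (0, t), by fun_prop⟩, rfl, rfl⟩
  let τ : Path ((0, 1) : I × I) (1, 1) := ⟨⟨fun s => (s, 1), by fun_prop⟩, rfl, rfl⟩
  have e1 : bot = β.map K.continuous := Path.ext (funext fun s => (hb s).symm)
  have e2 : right = ρ.map K.continuous := Path.ext (funext fun s => (hr s).symm)
  have e3 : left = l.map K.continuous := Path.ext (funext fun s => (hl s).symm)
  have e4 : top = τ.map K.continuous := Path.ext (funext fun s => (ht s).symm)
  have : ContractibleSpace I := (convex_Icc (0 : ℝ) 1).contractibleSpace ⟨0, by simp⟩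
  have h : (β.trans ρ).Homotopic (l.trans τ) := SimplyConnectedSpace.paths_homotopic _ _
  have := h.map K
  rw [Path.map_trans, Path.map_trans] at this
  rw [e1, e2, e3, e4, ← mk_trans, ← mk_trans, eq]
  exact this

theorem convexComb_mem_unitInterval {x y : ℝ} (t : I) (hx : x ∈ I) (hy : y ∈ I) :
    (1 - (t : ℝ)) * x + t * y ∈ I :=
  convex_Icc (0 : ℝ) 1 hx hy (sub_nonneg.2 t.2.2) t.2.1 (sub_add_cancel _ _)

theorem min_two_mul_mem_unitInterval (s : I) : min (2 * (s : ℝ)) 1 ∈ I :=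
  ⟨le_min (by linarith [s.2.1]) zero_le_one, min_le_right _ _⟩

theorem max_two_mul_sub_mem_unitInterval (s : I) : max (2 * (s : ℝ) - 1) 0 ∈ I :=
  ⟨le_max_right _ _, max_le (by linarith [s.2.2]) zero_le_one⟩

/-- The map from the square to itself that collapses the left and the right edge, and sends the
bottom edge to the lower right and the top edge to the upper left part of the boundary. -/
noncomputable def bigonMap : C(I × I, I × I) where
  toFun q :=
    (⟨(1 - q.2) * min (2 * (q.1 : ℝ)) 1 + q.2 * max (2 * (q.1 : ℝ) - 1) 0,
      convexComb_mem_unitInterval _ (min_two_mul_mem_unitInterval _)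
        (max_two_mul_sub_mem_unitInterval _)⟩,
     ⟨(1 - q.2) * max (2 * (q.1 : ℝ) - 1) 0 + q.2 * min (2 * (q.1 : ℝ)) 1,
      convexComb_mem_unitInterval _ (max_two_mul_sub_mem_unitInterval _)
        (min_two_mul_mem_unitInterval _)⟩)
  continuous_toFun := by fun_prop

theorem bigonMap_fst (q : I × I) : ((bigonMap q).1 : ℝ) =
    (1 - q.2) * min (2 * (q.1 : ℝ)) 1 + q.2 * max (2 * (q.1 : ℝ) - 1) 0 := rfl

theorem bigonMap_snd (q : I × I) : ((bigonMap q).2 : ℝ) =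
    (1 - q.2) * max (2 * (q.1 : ℝ) - 1) 0 + q.2 * min (2 * (q.1 : ℝ)) 1 := rfl

theorem min_add_max_eq_two_mul (s : ℝ) : min (2 * s) 1 + max (2 * s - 1) 0 = 2 * s := by
  rcases le_total (2 * s) 1 with h | h
  · rw [min_eq_left h, max_eq_right (by linarith)]; ring
  · rw [min_eq_right h, max_eq_left (by linarith)]; ring

/-- For fixed s, the map in t runs affinely along the chord x + y = 2s of the square, from the lower
right to the upper left part of the boundary. These chords fill the square and degenerate to points
only for s = 0 and s = 1. -/
theorem bigonMap_surjective : Function.Surjective bigonMap := by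
  rintro ⟨x, y⟩
  have hx0 := x.2.1; have hx1 := x.2.2; have hy0 := y.2.1; have hy1 := y.2.2
  let s : I := ⟨((x : ℝ) + y) / 2, by constructor <;> linarith⟩
  have hs : (2 * (s : ℝ)) = x + y := by simp only [s]; ring
  set m : ℝ := min (2 * (s : ℝ)) 1 with hm
  set k : ℝ := max (2 * (s : ℝ) - 1) 0 with hk
  have hmk : m + k = x + y := by rw [hm, hk, min_add_max_eq_two_mul, hs]
  have hxm : (x : ℝ) ≤ m := le_min (by linarith) hx1
  have hym : (y : ℝ) ≤ m := le_min (by linarith) hy1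
  rcases eq_or_ne m k with h | h
  · refine ⟨(s, 0), Prod.ext (Subtype.ext ?_) (Subtype.ext ?_)⟩
    · rw [bigonMap_fst]; simp only [← hm, ← hk]; simp; linarith
    · rw [bigonMap_snd]; simp only [← hm, ← hk]; simp; linarith
  · have hlt : 0 < m - k := lt_of_le_of_ne (by linarith) (sub_ne_zero.2 h).symm
    refine ⟨(s, ⟨(m - x) / (m - k), div_nonneg (by linarith) hlt.le,
      (div_le_one hlt).2 (by linarith)⟩), Prod.ext (Subtype.ext ?_) (Subtype.ext ?_)⟩
    · rw [bigonMap_fst]; simp only [← hm, ← hk]; field_simp; ring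
    · rw [bigonMap_snd]; simp only [← hm, ← hk]
      have : (y : ℝ) = m + k - x := by linarith
      rw [this]; field_simp; ring

theorem eq_or_of_bigonMap_eq {q q' : I × I} (h : bigonMap q = bigonMap q') :
    q = q' ∨ (q.1 = 0 ∧ q'.1 = 0) ∨ (q.1 = 1 ∧ q'.1 = 1) := by
  obtain ⟨s, t⟩ := q
  obtain ⟨s', t'⟩ := q'
  have h1 : ((bigonMap (s, t)).1 : ℝ) = (bigonMap (s', t')).1 := by rw [h]
  have h2 : ((bigonMap (s, t)).2 : ℝ) = (bigonMap (s', t')).2 := by rw [h]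
  rw [bigonMap_fst, bigonMap_fst] at h1
  rw [bigonMap_snd, bigonMap_snd] at h2
  dsimp only at h1 h2
  have hs : (s : ℝ) = s' := by
    have e1 := min_add_max_eq_two_mul s
    have e2 := min_add_max_eq_two_mul s'
    linarith
  obtain rfl : s = s' := Subtype.ext hs
  by_cases h0 : s = 0
  · exact Or.inr (Or.inl ⟨h0, h0⟩)
  by_cases h1' : s = 1
  · exact Or.inr (Or.inr ⟨h1', h1'⟩)
  left
  have s0 : (0 : ℝ) < s := lt_of_le_of_ne s.2.1 fun hc => h0 (Subtype.ext hc.symm)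
  have s1 : (s : ℝ) < 1 := lt_of_le_of_ne s.2.2 fun hc => h1' (Subtype.ext hc)
  have hlt : max (2 * (s : ℝ) - 1) 0 < min (2 * (s : ℝ)) 1 :=
    max_lt (lt_min (by linarith) (by linarith)) (lt_min (by linarith) one_pos)
  have : ((t : ℝ) - t') * (min (2 * (s : ℝ)) 1 - max (2 * (s : ℝ) - 1) 0) = 0 := by linarith
  rcases mul_eq_zero.1 this with h | h
  · rw [show t = t' from Subtype.ext (by linarith)]
  · linarith

/-- A commutative square in the fundamental groupoid is the boundary of a singular square. -/
theorem Path.exists_square_of_mk_trans_eq {a b c d : Y}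
    (bot : Path a b) (right : Path b c) (left : Path a d) (top : Path d c)
    (h : (Path.Homotopic.Quotient.mk bot).trans (.mk right) =
      (Path.Homotopic.Quotient.mk left).trans (.mk top)) :
    ∃ K : C(I × I, Y), (∀ s, K (s, 0) = bot s) ∧ (∀ t, K (1, t) = right t) ∧
      (∀ t, K (0, t) = left t) ∧ (∀ s, K (s, 1) = top s) := by
  rw [← Path.Homotopic.Quotient.mk_trans, ← Path.Homotopic.Quotient.mk_trans,
    Path.Homotopic.Quotient.eq] at h
  obtain ⟨H⟩ := h
  let H' : C(I × I, Y) := H.toContinuousMap.comp ⟨Prod.swap, by fun_prop⟩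
  have hH' : ∀ s t, H' (s, t) = H (t, s) := fun _ _ => rfl
  -- A path homotopy is constant on the two edges collapsed by `bigonMap`, so it descends along this
  -- quotient map to a square whose boundary consists of the four given paths.
  have hq : IsQuotientMap bigonMap :=
    bigonMap.continuous.isClosedMap.isQuotientMap bigonMap.continuous bigonMap_surjective
  have hcompat : Function.FactorsThrough H' bigonMap := by
    rintro ⟨s, t⟩ ⟨s', t'⟩ hqq
    rcases eq_or_of_bigonMap_eq hqq with h | ⟨h, h'⟩ | ⟨h, h'⟩
    · rw [h]
    · dsimp only at h h'
      subst h h'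
      simp [hH']
    · dsimp only at h h'
      subst h h'
      simp [hH']
  let K : C(I × I, Y) := hq.lift H' hcompat
  have hK : ∀ s t, K (bigonMap (s, t)) = H (t, s) := fun s t =>
    DFunLike.congr_fun (hq.lift_comp H' hcompat) (s, t)
  have half : ∀ s : I, (s : ℝ) / 2 ∈ I := fun s => ⟨by linarith [s.2.1], by linarith [s.2.2]⟩
  have half' : ∀ s : I, ((s : ℝ) + 1) / 2 ∈ I :=
    fun s => ⟨by linarith [s.2.1], by linarith [s.2.2]⟩
  have e1 : ∀ s : I, min (2 * ((s : ℝ) / 2)) 1 = s := fun s => by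
    rw [min_eq_left (by linarith [s.2.2])]; ring
  have e2 : ∀ s : I, max (2 * ((s : ℝ) / 2) - 1) 0 = 0 := fun s => by
    rw [max_eq_right (by linarith [s.2.2])]
  have e3 : ∀ s : I, min (2 * (((s : ℝ) + 1) / 2)) 1 = 1 := fun s => by
    rw [min_eq_right (by linarith [s.2.1])]
  have e4 : ∀ s : I, max (2 * (((s : ℝ) + 1) / 2) - 1) 0 = s := fun s => by
    rw [max_eq_left (by linarith [s.2.1])]; ring
  have trans_half : ∀ {u v w : Y} (γ : Path u v) (γ' : Path v w) (s : I),
      (γ.trans γ') ⟨s / 2, half s⟩ = γ s := by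
    intro u v w γ γ' s
    rw [Path.trans_apply, dif_pos (by dsimp only; linarith [s.2.2])]
    congr 1
    exact Subtype.ext (by dsimp only; ring)
  have trans_half' : ∀ {u v w : Y} (γ : Path u v) (γ' : Path v w) (s : I),
      (γ.trans γ') ⟨(s + 1) / 2, half' s⟩ = γ' s := by
    intro u v w γ γ' s
    rw [Path.trans_apply]
    split_ifs with hs
    · have h0 : s = 0 := le_antisymm (Subtype.coe_le_coe.1 (by dsimp only at hs; simp; linarith)) s.2.1
      subst h0
      rw [γ'.source]
      convert γ.target using 2
      exact Subtype.ext (by simp)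
    · congr 1
      exact Subtype.ext (by dsimp only; ring)
  refine ⟨K, fun s => ?_, fun t => ?_, fun t => ?_, fun s => ?_⟩
  · have : bigonMap (⟨s / 2, half s⟩, 0) = (s, 0) :=
      Prod.ext (Subtype.ext (by rw [bigonMap_fst]; simp only [e1, e2]; simp))
        (Subtype.ext (by rw [bigonMap_snd]; simp only [e1, e2]; simp))
    rw [← this, hK, H.apply_zero, ← trans_half bot right s]
    rfl
  · have : bigonMap (⟨(t + 1) / 2, half' t⟩, 0) = (1, t) :=
      Prod.ext (Subtype.ext (by rw [bigonMap_fst]; simp only [e3, e4]; simp))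
        (Subtype.ext (by rw [bigonMap_snd]; simp only [e3, e4]; simp))
    rw [← this, hK, H.apply_zero, ← trans_half' bot right t]
    rfl
  · have : bigonMap (⟨t / 2, half t⟩, 1) = (0, t) :=
      Prod.ext (Subtype.ext (by rw [bigonMap_fst]; simp only [e1, e2]; simp))
        (Subtype.ext (by rw [bigonMap_snd]; simp only [e1, e2]; simp))
    rw [← this, hK, H.apply_one, ← trans_half left top t]
    rfl
  · have : bigonMap (⟨(s + 1) / 2, half' s⟩, 1) = (s, 1) :=
      Prod.ext (Subtype.ext (by rw [bigonMap_fst]; simp only [e3, e4]; simp))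
        (Subtype.ext (by rw [bigonMap_snd]; simp only [e3, e4]; simp))
    rw [← this, hK, H.apply_one, ← trans_half' left top s]
    rfl

end Squares

/-! ### Calculus in the fundamental groupoid -/

namespace Path.Homotopic.Quotient

variable {X Y : Type*} [TopologicalSpace X] [TopologicalSpace Y] {x y z w : X}

@[simp]
theorem symm_trans_trans (γ : Homotopic.Quotient x y) (δ : Homotopic.Quotient y z) :
    γ.symm.trans (γ.trans δ) = δ := by
  rw [← trans_assoc, symm_trans, refl_trans]

@[simp]
theorem trans_symm_trans (γ : Homotopic.Quotient x y) (δ : Homotopic.Quotient x z) :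
    γ.trans (γ.symm.trans δ) = δ := by
  rw [← trans_assoc, trans_symm, refl_trans]

theorem trans_left_cancel {γ : Homotopic.Quotient x y} {δ δ' : Homotopic.Quotient y z}
    (h : γ.trans δ = γ.trans δ') : δ = δ' := by
  rw [← symm_trans_trans γ δ, h, symm_trans_trans]

theorem trans_right_cancel {γ γ' : Homotopic.Quotient x y} {δ : Homotopic.Quotient y z}
    (h : γ.trans δ = γ'.trans δ) : γ = γ' := by
  have := congrArg (fun c => c.trans δ.symm) h
  simpa using this

@[simp]
theorem symm_symm (γ : Homotopic.Quotient x y) : γ.symm.symm = γ :=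
  trans_left_cancel (γ := γ.symm) (by simp)

@[simp]
theorem symm_trans_eq (γ : Homotopic.Quotient x y) (δ : Homotopic.Quotient y z) :
    (γ.trans δ).symm = δ.symm.trans γ.symm :=
  trans_left_cancel (γ := γ.trans δ) (by simp)

@[simp]
theorem symm_refl : (refl x).symm = refl x :=
  trans_left_cancel (γ := refl x) (by simp)

theorem eq_trans_symm_of_trans_eq {γ : Homotopic.Quotient x y} {δ : Homotopic.Quotient y z}
    {ε : Homotopic.Quotient x z} (h : γ.trans δ = ε) : γ = ε.trans δ.symm := by
  rw [← h]; simp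

theorem map_trans (γ : Homotopic.Quotient x y) (δ : Homotopic.Quotient y z) (f : C(X, Y)) :
    (γ.trans δ).map f = (γ.map f).trans (δ.map f) := by
  induction γ, δ using Quotient.ind₂ with | mk γ δ =>
  rw [← mk_trans, ← mk_map, Path.map_trans]
  rfl

theorem map_symm (γ : Homotopic.Quotient x y) (f : C(X, Y)) : γ.symm.map f = (γ.map f).symm := by
  induction γ using Quotient.ind with | mk γ =>
  rfl

theorem mk_eq_refl_of_forall {γ : Path x x} (h : ∀ t, γ t = x) : mk γ = refl x := by
  rw [← mk_refl]
  congr 1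
  exact Path.ext (funext h)

theorem mk_eq_mk_of_forall {γ γ' : Path x y} (h : ∀ t, γ t = γ' t) : mk γ = mk γ' :=
  congrArg mk (Path.ext (funext h))

end Path.Homotopic.Quotient

/-! ### Lifting of paths and squares, and π₁-injectivity of fibres -/

section Lifting

open unitInterval

open Path

variable {E B F : Type*} [TopologicalSpace E] [TopologicalSpace B] [TopologicalSpace F]

theorem IsFibreBundle.exists_path_lift {p : E → B} (hp : IsFibreBundle F p) {x : E} {b : B}
    (ω : Path (p x) b) : ∃ (y : E) (g : Path x y), ∀ t, p (g t) = ω t := by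
  obtain ⟨T⟩ := exists_trivAlong_interval hp (ω : C(I, B))
  have hx : T.point (0, T.coord (0, x)) = x := T.point_coord 0 trivial x ω.source.symm
  refine ⟨T.point (1, T.coord (0, x)), ⟨⟨fun t => T.point (t, T.coord (0, x)), ?_⟩, hx, rfl⟩, ?_⟩
  · exact T.continuous_point.comp (by fun_prop)
  · exact fun t => T.proj_point t trivial _

/-- If the projection of a path is homotopic to `ω`, then the path is homotopic to a lift
of `ω`. -/
theorem IsFibreBundle.exists_lift_of_mk_map_eq {p : C(E, B)} (hp : IsFibreBundle F p) {x y : E}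
    (β : Homotopic.Quotient x y) (ω : Path (p x) (p y)) (h : β.map p = .mk ω) :
    ∃ g : Path x y, (∀ t, p (g t) = ω t) ∧ Homotopic.Quotient.mk g = β := by
  induction β using Homotopic.Quotient.ind with | mk β =>
  rw [← Homotopic.Quotient.mk_map, Homotopic.Quotient.eq] at h
  obtain ⟨H⟩ := h
  obtain ⟨T⟩ := exists_trivAlong_square hp H.toContinuousMap
  have h0 : ∀ s, p (β s) = H (0, s) := fun s => (H.apply_zero s).symm
  have hs : ∀ t, p x = H (t, 0) := fun t => (H.source t).symm
  have ht : ∀ t, p y = H (t, 1) := fun t => (H.target t).symm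
  let bot : Path (T.coord ((0, 0), x)) (T.coord ((1, 0), x)) :=
    ⟨⟨fun t => T.coord ((t, 0), x), T.continuous_coord (f := fun t => (t, 0)) (by fun_prop)
      (by fun_prop) hs⟩, rfl, rfl⟩
  let top : Path (T.coord ((0, 1), y)) (T.coord ((1, 1), y)) :=
    ⟨⟨fun t => T.coord ((t, 1), y), T.continuous_coord (f := fun t => (t, 1)) (by fun_prop)
      (by fun_prop) ht⟩, rfl, rfl⟩
  let left : Path (T.coord ((0, 0), x)) (T.coord ((0, 1), y)) :=
    ⟨⟨fun s => T.coord ((0, s), β s), T.continuous_coord (f := fun s => (0, s)) (by fun_prop)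
      β.continuous h0⟩, by simp, by simp⟩
  -- Three edges are prescribed: β over one, constant end points in E over two. The edge over ω is
  -- free, so its fibre coordinate is taken to be the composite that makes the square in F commute.
  obtain ⟨K, hK1, hK2, hK3, hK4⟩ := Path.exists_square_of_mk_trans_eq bot
    (bot.symm.trans (left.trans top)) left top (by simp)
  let G : C(I × I, E) := ⟨fun q => T.point (q, K q), T.continuous_point.comp (by fun_prop)⟩
  have hG0 : ∀ s, G (0, s) = β s := fun s => by
    simp only [G, ContinuousMap.coe_mk, hK3]
    exact T.point_coord _ trivial _ (h0 s)
  have hGs : ∀ t, G (t, 0) = x := fun t => by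
    simp only [G, ContinuousMap.coe_mk, hK1]
    exact T.point_coord _ trivial _ (hs t)
  have hGt : ∀ t, G (t, 1) = y := fun t => by
    simp only [G, ContinuousMap.coe_mk, hK4]
    exact T.point_coord _ trivial _ (ht t)
  refine ⟨⟨⟨fun s => G (1, s), by fun_prop⟩, hGs 1, hGt 1⟩, fun s => ?_, ?_⟩
  · exact (T.proj_point _ trivial _).trans (H.apply_one s)
  · have := Homotopic.Quotient.mk_trans_eq_of_square G (Path.refl x)
      ⟨⟨fun s => G (1, s), by fun_prop⟩, hGs 1, hGt 1⟩ β (Path.refl y) hGs (fun _ => rfl) hG0 hGt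
    simpa using this

/-- Every loop at `x` in the fibre of `p` through `x` that is null-homotopic in the total space is
null-homotopic in the fibre. -/
def FibreLoopsInject (p : E → B) (x : E) : Prop :=
  ∀ α : Path x x, (∀ t, p (α t) = p x) → Homotopic.Quotient.mk α = .refl x →
    ∃ H : α.Homotopy (Path.refl x), ∀ q, p (H q) = p x

theorem fibreLoopsInject_iff_injective (p : C(E, B)) (x : E) :
    FibreLoopsInject p x ↔
      Function.Injective (FundamentalGroup.map (fibreInclusion p (p x)) ⟨x, rfl⟩) := by
  rw [injective_iff_map_eq_one]
  constructor
  · intro h a ha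
    induction a using Homotopic.Quotient.ind with | mk a =>
    obtain ⟨H, hH⟩ := h (a.map continuous_subtype_val) (fun t => (a t).2) ha
    refine Homotopic.Quotient.eq.2 ⟨⟨⟨⟨fun q => ⟨H q, hH q⟩, by fun_prop⟩, ?_, ?_⟩, ?_⟩⟩
    · exact fun s => Subtype.ext (H.apply_zero s)
    · exact fun s => Subtype.ext (H.apply_one s)
    · exact fun t s hs => Subtype.ext (H.eq_fst t hs)
  · intro h α hα hα1
    let a : Path (⟨x, rfl⟩ : p ⁻¹' {p x}) ⟨x, rfl⟩ :=
      ⟨⟨fun t => ⟨α t, hα t⟩, by fun_prop⟩, Subtype.ext α.source, Subtype.ext α.target⟩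
    have h1 := h (Homotopic.Quotient.mk a) hα1
    obtain ⟨H⟩ := Homotopic.Quotient.eq.1 h1
    refine ⟨⟨⟨⟨fun q => H q, by fun_prop⟩, ?_, ?_⟩, ?_⟩, fun q => (H q).2⟩
    · exact fun s => congrArg Subtype.val (H.apply_zero s)
    · exact fun s => congrArg Subtype.val (H.apply_one s)
    · exact fun t s hs => congrArg Subtype.val (H.eq_fst t hs)

namespace TrivAlong

variable {X : Type*} [TopologicalSpace X] {p : E → B} {ω : X → B}

/-- The inclusion of the fibre over a point given by a trivialization. -/
def fibreMap (T : TrivAlong F p ω Set.univ) (q : X) : C(F, E) :=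
  ⟨fun f => T.point (q, f), T.continuous_point.comp (by fun_prop)⟩

/-- The trivialization identifies F with the fibre over `ω q`, so π₁-injectivity passes from that
fibre to F. -/
theorem mk_eq_refl_of_fibreMap (T : TrivAlong F p ω Set.univ) (q : X) {f : F} (a : Path f f)
    (hinj : FibreLoopsInject p (T.point (q, f)))
    (h : (Homotopic.Quotient.mk a).map (T.fibreMap q) = .refl _) :
    Homotopic.Quotient.mk a = .refl f := by
  have hproj : ∀ f, p (T.point (q, f)) = ω q := T.proj_point q trivial
  obtain ⟨H, hH⟩ := hinj (a.map (T.fibreMap q).continuous) (fun t => by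
    rw [hproj]; exact hproj _) h
  refine Homotopic.Quotient.eq.2 ⟨⟨⟨⟨fun u => T.coord (q, H u), ?_⟩, fun s => ?_, fun s => ?_⟩,
    fun t s hs => ?_⟩⟩
  · exact T.continuous_coord continuous_const H.continuous fun u => (hH u).trans (hproj f)
  · dsimp only
    rw [H.apply_zero]
    exact T.coord_point q trivial _
  · dsimp only
    rw [H.apply_one]
    exact T.coord_point q trivial _
  · have := H.eq_fst t hs
    change T.coord (q, H (t, s)) = a s
    rw [this]
    exact T.coord_point q trivial _

end TrivAlong

/-- In a trivialization along p ∘ ρ, the loop α slides through the fibres to a loop over the start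
of ρ that is still null-homotopic in E. Its base point need not be x, so its coordinate is
conjugated by the coordinate `r` of ρ before the hypothesis at x is applied. -/
theorem FibreLoopsInject.of_path {p : C(E, B)} (hp : IsFibreBundle F p) {x y : E} (ρ : Path x y)
    (hx : FibreLoopsInject p x) : FibreLoopsInject p y := by
  obtain ⟨T⟩ := exists_trivAlong_interval hp (p.comp (ρ : C(I, E)))
  intro α hα hα1
  have hα' : ∀ s, p (α s) = (p.comp (ρ : C(I, E))) 1 := fun s => by simp [hα]
  let r : Path (T.coord (0, x)) (T.coord (1, y)) :=
    ⟨⟨fun t => T.coord (t, ρ t), T.continuous_coord (by fun_prop) (by fun_prop) fun _ => rfl⟩,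
      by simp, by simp⟩
  let a : Path (T.coord (1, y)) (T.coord (1, y)) :=
    ⟨⟨fun s => T.coord (1, α s), T.continuous_coord (f := fun _ => 1) (by fun_prop) (by fun_prop)
      hα'⟩, by simp, by simp⟩
  have hpt0 : T.point (0, T.coord (0, x)) = x := T.point_coord 0 trivial x (by simp)
  have hpt1 : ∀ s, T.point (1, T.coord (1, α s)) = α s := fun s =>
    T.point_coord 1 trivial _ (hα' s)
  have hpt1y : T.point (1, T.coord (1, y)) = y := T.point_coord 1 trivial y (by simp)
  let K : C(I × I, E) := ⟨fun q => T.point (q.2, a q.1), T.continuous_point.comp (by fun_prop)⟩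
  let v : Path (T.point (0, T.coord (1, y))) y :=
    ⟨⟨fun t => T.point (t, T.coord (1, y)), T.continuous_point.comp (by fun_prop)⟩, rfl, hpt1y⟩
  have hsq := Homotopic.Quotient.mk_trans_eq_of_square K (a.map (T.fibreMap 0).continuous) v v α
    (fun _ => rfl) (fun t => congrArg (fun f => T.point (t, f)) a.target)
    (fun t => congrArg (fun f => T.point (t, f)) a.source) hpt1
  have ha0 : (Homotopic.Quotient.mk a).map (T.fibreMap 0) = .refl _ := by
    refine Homotopic.Quotient.trans_right_cancel (δ := Homotopic.Quotient.mk v) ?_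
    rw [hα1] at hsq
    rw [← Homotopic.Quotient.mk_map, hsq]
    simp
  have hnull : Homotopic.Quotient.mk (r.trans (a.trans r.symm)) = .refl _ := by
    refine T.mk_eq_refl_of_fibreMap 0 _ (by rwa [hpt0]) ?_
    simp only [Homotopic.Quotient.mk_trans, Homotopic.Quotient.map_trans, ha0,
      Homotopic.Quotient.mk_symm, Homotopic.Quotient.map_symm]
    simp
  have ha : Homotopic.Quotient.mk a = .refl _ := by
    simp only [Homotopic.Quotient.mk_trans, Homotopic.Quotient.mk_symm] at hnull
    refine Homotopic.Quotient.trans_left_cancel (γ := Homotopic.Quotient.mk r)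
      (Homotopic.Quotient.trans_right_cancel (δ := (Homotopic.Quotient.mk r).symm) ?_)
    simpa using hnull
  obtain ⟨H⟩ := Homotopic.Quotient.eq.1 ha
  refine ⟨⟨⟨⟨fun u => T.point (1, H u), T.continuous_point.comp (by fun_prop)⟩, fun s => ?_,
    fun s => ?_⟩, fun t s hs => ?_⟩, fun q => ?_⟩
  · dsimp only
    rw [H.apply_zero]
    exact hpt1 s
  · dsimp only
    rw [H.apply_one]
    exact hpt1y
  · change T.point (1, H (t, s)) = α s
    rw [H.eq_fst t hs]
    exact hpt1 s
  · exact (T.proj_point 1 trivial _).trans (by simp)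

/-- With H a contraction of α in E, the coordinates `h` of H and `k` of s ∘ p ∘ H agree wherever H
equals `s b`, that is, on three edges. Hence their remaining edges are homotopic in F; these are the
coordinates of α and of the constant loop, both over the constant path at b. -/
theorem fibreLoopsInject_of_section {p : C(E, B)} (hp : IsFibreBundle F p) (s : C(B, E))
    (hs : ∀ b, p (s b) = b) (b : B) : FibreLoopsInject p (s b) := by
  intro α hα hα1
  obtain ⟨H⟩ := Homotopic.Quotient.eq.1 hα1
  let ω : C(I × I, B) := p.comp H.toContinuousMap
  have hω : ∀ q, ω q = p (H q) := fun _ => rfl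
  obtain ⟨T⟩ := exists_trivAlong_square hp ω
  let h : C(I × I, F) := ⟨fun q => T.coord (q, H q),
    T.continuous_coord continuous_id H.continuous fun _ => rfl⟩
  let k : C(I × I, F) := ⟨fun q => T.coord (q, s (ω q)),
    T.continuous_coord continuous_id (by fun_prop) fun q => hs (ω q)⟩
  have e : ∀ q, H q = s b → k q = h q := by
    intro q hq
    simp only [h, k, ContinuousMap.coe_mk, hω]
    rw [hq, hs]
  have e0 : ∀ t, k (t, 0) = h (t, 0) := fun t => e _ (H.source t)
  have e1 : ∀ t, k (t, 1) = h (t, 1) := fun t => e _ (H.target t)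
  have e2 : ∀ t, k (1, t) = h (1, t) := fun t => e _ (H.apply_one t)
  let bot : Path (h (0, 0)) (h (1, 0)) := ⟨⟨fun t => h (t, 0), by fun_prop⟩, rfl, rfl⟩
  let top : Path (h (0, 1)) (h (1, 1)) := ⟨⟨fun t => h (t, 1), by fun_prop⟩, rfl, rfl⟩
  let right : Path (h (1, 0)) (h (1, 1)) := ⟨⟨fun t => h (1, t), by fun_prop⟩, rfl, rfl⟩
  let lh : Path (h (0, 0)) (h (0, 1)) := ⟨⟨fun t => h (0, t), by fun_prop⟩, rfl, rfl⟩
  let lk : Path (h (0, 0)) (h (0, 1)) := ⟨⟨fun t => k (0, t), by fun_prop⟩, e0 0, e1 0⟩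
  have hsq := Homotopic.Quotient.mk_trans_eq_of_square h bot right lh top (fun _ => rfl)
    (fun _ => rfl) (fun _ => rfl) (fun _ => rfl)
  have ksq := Homotopic.Quotient.mk_trans_eq_of_square k bot right lk top e0 e2 (fun _ => rfl) e1
  have hlk : Homotopic.Quotient.mk lh = Homotopic.Quotient.mk lk :=
    Homotopic.Quotient.trans_right_cancel (hsq.symm.trans ksq)
  obtain ⟨G⟩ := Homotopic.Quotient.eq.1 hlk
  have hω0 : ∀ u, ω (0, u) = b := fun u => by
    rw [hω, H.apply_zero, Path.coe_toContinuousMap, hα, hs]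
  have pt_h : ∀ u, T.point ((0, u), h (0, u)) = α u := fun u =>
    (T.point_coord _ trivial _ rfl).trans (H.apply_zero u)
  have pt_k : ∀ u, T.point ((0, u), k (0, u)) = s b := fun u =>
    (T.point_coord _ trivial _ (hs _)).trans (by rw [hω0])
  refine ⟨⟨⟨⟨fun q => T.point ((0, q.2), G q), T.continuous_point.comp (by fun_prop)⟩, fun u => ?_,
    fun u => ?_⟩, fun t u hu => ?_⟩, fun q => ?_⟩
  · dsimp only
    rw [G.apply_zero]
    exact pt_h u
  · dsimp only
    rw [G.apply_one]
    exact pt_k u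
  · change T.point ((0, u), G (t, u)) = α u
    rw [G.eq_fst t hu]
    exact pt_h u
  · exact (T.proj_point _ trivial _).trans (by rw [hω0, hs])

/-- A lift over the boundary of a square that commutes in the fundamental groupoid of the total
space extends to a lift over the square, if loops in the fibres inject. -/
theorem IsFibreBundle.exists_square_lift {p : C(E, B)} (hp : IsFibreBundle F p) (ω : C(I × I, B))
    {a b c d : E} (bot : Path a b) (right : Path b c) (left : Path a d) (top : Path d c)
    (hb : ∀ s, p (bot s) = ω (s, 0)) (hr : ∀ t, p (right t) = ω (1, t))
    (hl : ∀ t, p (left t) = ω (0, t)) (ht : ∀ s, p (top s) = ω (s, 1))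
    (h : (Homotopic.Quotient.mk bot).trans (.mk right) =
      (Homotopic.Quotient.mk left).trans (.mk top))
    (hinj : FibreLoopsInject p a) :
    ∃ K : C(I × I, E), (∀ q, p (K q) = ω q) ∧ (∀ s, K (s, 0) = bot s) ∧
      (∀ t, K (1, t) = right t) ∧ (∀ t, K (0, t) = left t) ∧ (∀ s, K (s, 1) = top s) := by
  obtain ⟨T⟩ := exists_trivAlong_square hp ω
  have key : ∀ {u v : E} {q q' : I × I} (γ : Path q q') (g : Path u v)
      (_ : ∀ s, p (g s) = ω (γ s)), ∃ g' : Path (T.coord (q, u)) (T.coord (q', v)),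
      (∀ s, T.point (γ s, g' s) = g s) := by
    intro u v q q' γ g hg
    exact ⟨⟨⟨fun s => T.coord (γ s, g s), T.continuous_coord γ.continuous g.continuous hg⟩,
      by simp, by simp⟩, fun s => T.point_coord _ trivial _ (hg s)⟩
  obtain ⟨bot', hb'⟩ := key (⟨⟨fun s => (s, 0), by fun_prop⟩, rfl, rfl⟩ :
    Path ((0, 0) : I × I) (1, 0)) bot hb
  obtain ⟨top', ht'⟩ := key (⟨⟨fun s => (s, 1), by fun_prop⟩, rfl, rfl⟩ :
    Path ((0, 1) : I × I) (1, 1)) top ht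
  obtain ⟨left', hl'⟩ := key (⟨⟨fun s => (0, s), by fun_prop⟩, rfl, rfl⟩ :
    Path ((0, 0) : I × I) (0, 1)) left hl
  obtain ⟨right', hr'⟩ := key (⟨⟨fun s => (1, s), by fun_prop⟩, rfl, rfl⟩ :
    Path ((1, 0) : I × I) (1, 1)) right hr
  dsimp only [Path.coe_mk', ContinuousMap.coe_mk] at hb' ht' hl' hr'
  -- `R q` moves a point over q into the fibre over the corner (0, 0) along the segment joining q to
  -- that corner, with constant fibre coordinate. By `slide`, these paths conjugate a path in E to
  -- its coordinate path placed in the corner fibre.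
  let R : ∀ {u : E} (q : I × I), p u = ω q → Path (T.fibreMap (0, 0) (T.coord (q, u))) u :=
    fun {u} q hq => ⟨⟨fun t => T.point ((t * q.1, t * q.2), T.coord (q, u)),
      T.continuous_point.comp (by fun_prop)⟩, by simp only [zero_mul]; rfl, by
        simp only [one_mul]
        exact T.point_coord q trivial u hq⟩
  have slide : ∀ {u v : E} {q q' : I × I} (γ : Path q q') (g : Path u v)
      (g' : Path (T.coord (q, u)) (T.coord (q', v))) (hq : p u = ω q) (hq' : p v = ω q'),
      (∀ s, T.point (γ s, g' s) = g s) →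
      ((Homotopic.Quotient.mk g').map (T.fibreMap (0, 0))).trans (.mk (R q' hq')) =
        (Homotopic.Quotient.mk (R q hq)).trans (.mk g) := by
    intro u v q q' γ g g' hq hq' hg
    rw [← Homotopic.Quotient.mk_map]
    refine Homotopic.Quotient.mk_trans_eq_of_square
      ⟨fun z => T.point ((z.2 * (γ z.1).1, z.2 * (γ z.1).2), g' z.1),
        T.continuous_point.comp (by fun_prop)⟩ _ _ _ _ ?_ ?_ ?_ ?_
    · intro s; simp only [ContinuousMap.coe_mk, zero_mul]; rfl
    · intro t; simp only [ContinuousMap.coe_mk, Path.target]; rfl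
    · intro t; simp only [ContinuousMap.coe_mk, Path.source]; rfl
    · intro s; simp [← hg]
  have ha : p a = ω (0, 0) := by rw [← hb, bot.source]
  have hb1 : p b = ω (1, 0) := by rw [← hb, bot.target]
  have hc : p c = ω (1, 1) := by rw [← ht, top.target]
  have hd : p d = ω (0, 1) := by rw [← ht, top.source]
  have s1 := slide (q := (0, 0)) (q' := (1, 0)) ⟨⟨fun s => (s, 0), by fun_prop⟩, rfl, rfl⟩
    bot bot' ha hb1 hb'
  have s2 := slide (q := (0, 1)) (q' := (1, 1)) ⟨⟨fun s => (s, 1), by fun_prop⟩, rfl, rfl⟩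
    top top' hd hc ht'
  have s3 := slide (q := (0, 0)) (q' := (0, 1)) ⟨⟨fun s => (0, s), by fun_prop⟩, rfl, rfl⟩
    left left' ha hd hl'
  have s4 := slide (q := (1, 0)) (q' := (1, 1)) ⟨⟨fun s => (1, s), by fun_prop⟩, rfl, rfl⟩
    right right' hb1 hc hr'
  -- Commutativity in E is thus inherited by the coordinate paths placed in the corner fibre;
  -- π₁-injectivity then gives commutativity in F itself, where the square can be filled.
  have hE : ((Homotopic.Quotient.mk bot').trans (.mk right')).map (T.fibreMap (0, 0)) =
      ((Homotopic.Quotient.mk left').trans (.mk top')).map (T.fibreMap (0, 0)) := by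
    refine Homotopic.Quotient.trans_right_cancel (δ := .mk (R (1, 1) hc)) ?_
    rw [Homotopic.Quotient.map_trans, Homotopic.Quotient.map_trans,
      Homotopic.Quotient.trans_assoc, Homotopic.Quotient.trans_assoc, s4, s2,
      ← Homotopic.Quotient.trans_assoc, ← Homotopic.Quotient.trans_assoc, s1, s3,
      Homotopic.Quotient.trans_assoc, Homotopic.Quotient.trans_assoc, h]
  have hpta : T.point ((0, 0), T.coord ((0, 0), a)) = a := T.point_coord _ trivial _ ha
  have hnull := T.mk_eq_refl_of_fibreMap (0, 0)
    ((bot'.trans right').trans (left'.trans top').symm) (by rwa [hpta]) (by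
      rw [Homotopic.Quotient.mk_trans, Homotopic.Quotient.mk_symm, Homotopic.Quotient.map_trans,
        Homotopic.Quotient.map_symm, Homotopic.Quotient.mk_trans, Homotopic.Quotient.mk_trans, hE,
        Homotopic.Quotient.trans_symm])
  obtain ⟨K, hK1, hK2, hK3, hK4⟩ := Path.exists_square_of_mk_trans_eq bot' right' left' top' (by
    refine Homotopic.Quotient.trans_right_cancel
      (δ := (Homotopic.Quotient.mk (left'.trans top')).symm) ?_
    rw [Homotopic.Quotient.mk_trans, Homotopic.Quotient.mk_symm,
      Homotopic.Quotient.mk_trans] at hnull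
    rw [hnull, Homotopic.Quotient.mk_trans, Homotopic.Quotient.trans_symm])
  refine ⟨⟨fun q => T.point (q, K q), T.continuous_point.comp (by fun_prop)⟩, ?_, ?_, ?_, ?_, ?_⟩
  · exact fun q => T.proj_point q trivial _
  · exact fun s => by simp only [ContinuousMap.coe_mk, hK1, hb']
  · exact fun s => by simp only [ContinuousMap.coe_mk, hK2, hr']
  · exact fun s => by simp only [ContinuousMap.coe_mk, hK3, hl']
  · exact fun s => by simp only [ContinuousMap.coe_mk, hK4, ht']

end Lifting

/-! ### Attaching a cell and generating the path classes -/

section CellAttachment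

open unitInterval

open Path Metric

theorem continuous_of_isClosedMap_cover {U V Y Z : Type*} [TopologicalSpace U]
    [TopologicalSpace V] [TopologicalSpace Y] [TopologicalSpace Z] {f : Y → Z} {u : U → Y}
    {v : V → Y} (hu : IsClosedMap u) (hv : IsClosedMap v)
    (hcover : ∀ y, y ∈ Set.range u ∨ y ∈ Set.range v) (hfu : Continuous (f ∘ u))
    (hfv : Continuous (f ∘ v)) : Continuous f := by
  refine continuous_iff_isClosed.2 fun S hS => ?_
  have : f ⁻¹' S = u '' ((f ∘ u) ⁻¹' S) ∪ v '' ((f ∘ v) ⁻¹' S) := by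
    ext y
    constructor
    · intro hy
      rcases hcover y with ⟨a, rfl⟩ | ⟨a, rfl⟩
      · exact Or.inl ⟨a, hy, rfl⟩
      · exact Or.inr ⟨a, hy, rfl⟩
    · rintro (⟨a, ha, rfl⟩ | ⟨a, ha, rfl⟩) <;> exact ha
  rw [this]
  exact (hu _ (hS.preimage hfu)).union (hv _ (hS.preimage hfv))

/-- The closed unit ball on which characteristic maps of `n`-cells are defined. -/
abbrev ModelCell (n : ℕ) : Type := closedBall (0 : Fin n → ℝ) 1

/-- The space `X` is obtained from the closed subset `A` by attaching a cell with characteristic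
map `Φ`. -/
structure IsCellAttachment {X : Type*} [TopologicalSpace X] {n : ℕ} (A : Set X)
    (Φ : C(ModelCell n, X)) : Prop where
  isClosed : IsClosed A
  cover : ∀ x, x ∈ A ∨ x ∈ Set.range Φ
  mem_of_norm_eq_one : ∀ d : ModelCell n, ‖(d : Fin n → ℝ)‖ = 1 → Φ d ∈ A
  notMem_of_norm_lt_one : ∀ d : ModelCell n, ‖(d : Fin n → ℝ)‖ < 1 → Φ d ∉ A
  injective : ∀ d d' : ModelCell n, ‖(d : Fin n → ℝ)‖ < 1 → Φ d = Φ d' → d = d'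

theorem norm_le_one_of_closedBall {n : ℕ} (d : ModelCell n) :
    ‖(d : Fin n → ℝ)‖ ≤ 1 := mem_closedBall_zero_iff.1 d.2

/-- The radial push of the unit ball towards its boundary, which stops at the unit sphere. -/
noncomputable def radialPush (n : ℕ) :
    C(I × ModelCell n, ModelCell n) where
  toFun q := ⟨((1 + (q.1 : ℝ)) / max 1 ((1 + (q.1 : ℝ)) * ‖(q.2 : Fin n → ℝ)‖)) •
      (q.2 : Fin n → ℝ), by
    have h0 : 0 ≤ 1 + (q.1 : ℝ) := by linarith [q.1.2.1]
    have h1 : 0 < max 1 ((1 + (q.1 : ℝ)) * ‖(q.2 : Fin n → ℝ)‖) := lt_max_of_lt_left one_pos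
    rw [mem_closedBall_zero_iff, norm_smul, Real.norm_of_nonneg (by positivity), div_mul_eq_mul_div,
      div_le_one h1]
    exact le_max_right _ _⟩
  continuous_toFun := by
    have h : Continuous fun q : I × ModelCell n =>
        (1 + (q.1 : ℝ)) / max 1 ((1 + (q.1 : ℝ)) * ‖(q.2 : Fin n → ℝ)‖) :=
      Continuous.div (by fun_prop) (by fun_prop) fun q => (lt_max_of_lt_left one_pos).ne'
    fun_prop

theorem radialPush_coe {n : ℕ} (t : I) (d : ModelCell n) :
    (radialPush n (t, d) : Fin n → ℝ) =
      ((1 + (t : ℝ)) / max 1 ((1 + (t : ℝ)) * ‖(d : Fin n → ℝ)‖)) • (d : Fin n → ℝ) := rfl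

theorem radialPush_zero {n : ℕ} (d : ModelCell n) : radialPush n (0, d) = d := by
  refine Subtype.ext ?_
  rw [radialPush_coe]
  simp [max_eq_left (norm_le_one_of_closedBall d)]

theorem radialPush_of_norm_eq_one {n : ℕ} (t : I) (d : ModelCell n)
    (hd : ‖(d : Fin n → ℝ)‖ = 1) : radialPush n (t, d) = d := by
  refine Subtype.ext ?_
  have h : (1 : ℝ) ≤ 1 + t := by linarith [t.2.1]
  rw [radialPush_coe, hd, mul_one, max_eq_right h, div_self (by linarith), one_smul]

theorem norm_radialPush_one {n : ℕ} (d : ModelCell n)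
    (hd : 1 / 2 ≤ ‖(d : Fin n → ℝ)‖) : ‖(radialPush n (1, d) : Fin n → ℝ)‖ = 1 := by
  have h : (1 : ℝ) ≤ (1 + 1) * ‖(d : Fin n → ℝ)‖ := by linarith
  have h' : ‖(d : Fin n → ℝ)‖ ≠ 0 := by linarith
  rw [radialPush_coe]
  simp only [Set.Icc.coe_one]
  rw [max_eq_right h, norm_smul, Real.norm_of_nonneg (by positivity)]
  field_simp

namespace IsCellAttachment

variable {X : Type*} [TopologicalSpace X] {n : ℕ} {A : Set X}
    {Φ : C(ModelCell n, X)}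

/-- The deformation of `X` that pushes the attached cell radially towards `A`. -/
theorem exists_deformation [T2Space X] (h : IsCellAttachment A Φ) : ∃ H : C(I × X, X),
    (∀ t, ∀ x ∈ A, H (t, x) = x) ∧ (∀ t d, H (t, Φ d) = Φ (radialPush n (t, d))) := by
  classical
  let H : I × X → X := fun q =>
    if hq : q.2 ∈ A then q.2 else Φ (radialPush n (q.1, ((h.cover q.2).resolve_left hq).choose))
  have hHA : ∀ t, ∀ x ∈ A, H (t, x) = x := fun t x hx => dif_pos hx
  have hHΦ : ∀ t d, H (t, Φ d) = Φ (radialPush n (t, d)) := by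
    intro t d
    rcases (norm_le_one_of_closedBall d).lt_or_eq with hd | hd
    · have hn := h.notMem_of_norm_lt_one d hd
      have hc := ((h.cover (Φ d)).resolve_left hn).choose_spec
      simp only [H]
      rw [dif_neg hn]
      exact congrArg (fun z => Φ (radialPush n (t, z))) (h.injective d _ hd hc.symm).symm
    · rw [hHA t _ (h.mem_of_norm_eq_one d hd), radialPush_of_norm_eq_one t d hd]
  -- Properness, unlike closedness alone, is preserved by the product with the interval.
  have hΦ : IsProperMap Φ := Φ.continuous.isProperMap
  have hval : IsProperMap (Subtype.val : A → X) :=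
    h.isClosed.isClosedEmbedding_subtypeVal.isProperMap
  refine ⟨⟨H, continuous_of_isClosedMap_cover (isProperMap_id.prodMap hval).isClosedMap
    (isProperMap_id.prodMap hΦ).isClosedMap (u := Prod.map (id : I → I) (Subtype.val : A → X))
    (v := Prod.map (id : I → I) Φ) ?_ ?_ ?_⟩, hHA, hHΦ⟩
  · rintro ⟨t, x⟩
    rcases h.cover x with hx | ⟨d, rfl⟩
    · exact Or.inl ⟨(t, ⟨x, hx⟩), rfl⟩
    · exact Or.inr ⟨(t, d), rfl⟩
  · have : H ∘ Prod.map (id : I → I) (Subtype.val : A → X) = fun q => (q.2 : X) :=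
      funext fun q => hHA _ _ q.2.2
    rw [this]
    fun_prop
  · have : H ∘ Prod.map (id : I → I) Φ = fun q => Φ (radialPush n q) :=
      funext fun q => hHΦ _ _
    rw [this]
    fun_prop

/-- On the open ball Φ is injective, and on the compact ball it is a closed map; so the preimage of
a closed set S under the pointwise lift is the closed set `ω ⁻¹' (Φ '' S)`. -/
theorem exists_lift_of_forall_notMem [T2Space X] (h : IsCellAttachment A Φ) (ω : C(I, X))
    (hω : ∀ t, ω t ∉ A) : ∃ δ : C(I, ModelCell n), ∀ t, Φ (δ t) = ω t := by
  choose δ hδ using fun t => (h.cover (ω t)).resolve_left (hω t)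
  refine ⟨⟨δ, continuous_iff_isClosed.2 fun S hS => ?_⟩, hδ⟩
  have : δ ⁻¹' S = ω ⁻¹' (Φ '' S) := by
    ext t
    constructor
    · exact fun ht => ⟨δ t, ht, hδ t⟩
    · rintro ⟨d, hd, hdt⟩
      have hnorm : ‖(δ t : Fin n → ℝ)‖ < 1 := (norm_le_one_of_closedBall _).lt_of_ne fun hc =>
        hω t (hδ t ▸ h.mem_of_norm_eq_one _ hc)
      have := h.injective _ d hnorm ((hδ t).trans hdt.symm)
      exact (this ▸ hd : δ t ∈ S)
  rw [this]
  exact (Φ.continuous.isClosedMap S hS).preimage ω.continuous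

/-- Path classes in a space obtained by attaching a cell to `A` are generated by paths in `A` and
paths in the cell. -/
theorem induction_on_path_class [T2Space X] (h : IsCellAttachment A Φ)
    {Q : ∀ {x y : X}, Homotopic.Quotient x y → Prop}
    (htrans : ∀ {x y z : X} (c : Homotopic.Quotient x y) (c' : Homotopic.Quotient y z),
      Q c → Q c' → Q (c.trans c'))
    (hsymm : ∀ {x y : X} (c : Homotopic.Quotient x y), Q c → Q c.symm)
    (hA : ∀ {x y : X} (ω : Path x y), (∀ t, ω t ∈ A) → Q (.mk ω))
    (hΦ : ∀ {d d'} (δ : Path d d'), Q (.mk (δ.map Φ.continuous)))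
    {x y : X} (c : Homotopic.Quotient x y) : Q c := by
  have hcongr : ∀ {x y x' y' : X} (ω : Path x y) (ω' : Path x' y'), (∀ t, ω t = ω' t) →
      Q (.mk ω) → Q (.mk ω') := by
    intro x y x' y' ω ω' hω hQ
    obtain rfl : x = x' := by rw [← ω.source, hω, ω'.source]
    obtain rfl : y = y' := by rw [← ω.target, hω, ω'.target]
    rwa [← Homotopic.Quotient.mk_eq_mk_of_forall hω]
  have hΦ' : ∀ {x y : X} (ω : Path x y) (δ : C(I, ModelCell n)),
      (∀ t, Φ (δ t) = ω t) → Q (.mk ω) := fun ω δ hδ =>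
    hcongr ((⟨δ, rfl, rfl⟩ : Path (δ 0) (δ 1)).map Φ.continuous) ω hδ (hΦ _)
  obtain ⟨H, hHA, hHΦ⟩ := h.exists_deformation
  have hH0 : ∀ x, H (0, x) = x := fun x => by
    rcases h.cover x with hx | ⟨d, rfl⟩
    · exact hHA 0 x hx
    · rw [hHΦ, radialPush_zero]
  -- The complements of A and of S form an open cover. A path off A lies in the open cell. A path
  -- off S is pushed into A at time 1, since radius 1/2 already reaches the sphere; the tracks of
  -- its end points stay in A or in the cell.
  let S : Set X := Φ '' {d | ‖(d : Fin n → ℝ)‖ ≤ 1 / 2}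
  have hS : IsClosed S := Φ.continuous.isClosedMap _
    (isClosed_le (by fun_prop) continuous_const)
  have hH1 : ∀ x ∉ S, H (1, x) ∈ A := by
    intro x hx
    rcases h.cover x with hxA | ⟨d, rfl⟩
    · rwa [hHA 1 x hxA]
    · rw [hHΦ]
      refine h.mem_of_norm_eq_one _ (norm_radialPush_one d ?_)
      by_contra! hc
      exact hx ⟨d, hc.le, rfl⟩
  let track : ∀ x : X, Path x (H (1, x)) := fun x =>
    ⟨⟨fun t => H (t, x), by fun_prop⟩, hH0 x, rfl⟩
  have htrack : ∀ x, Q (.mk (track x)) := by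
    intro x
    rcases h.cover x with hxA | ⟨d, rfl⟩
    · exact hA _ fun t => by
        change H (t, x) ∈ A
        rwa [hHA t x hxA]
    · exact hΦ' _ ⟨fun t => radialPush n (t, d), by fun_prop⟩ fun t => (hHΦ t d).symm
  have houter : ∀ {x y : X} (ω : Path x y), (∀ t, ω t ∉ S) → Q (.mk ω) := by
    intro x y ω hω
    let ω' : Path (H (1, x)) (H (1, y)) :=
      ⟨⟨fun t => H (1, ω t), by fun_prop⟩, by simp, by simp⟩
    have hsq := Homotopic.Quotient.mk_trans_eq_of_square
      ⟨fun q => H (q.2, ω q.1), by fun_prop⟩ ω (track y) (track x) ω'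
      (fun s => hH0 _) (fun t => congrArg (fun z => H (t, z)) ω.target)
      (fun t => congrArg (fun z => H (t, z)) ω.source) (fun s => rfl)
    rw [Homotopic.Quotient.eq_trans_symm_of_trans_eq hsq]
    exact htrans _ _ (htrans _ _ (htrack x) (hA ω' fun t => hH1 _ (hω t))) (hsymm _ (htrack y))
  have hinner : ∀ {x y : X} (ω : Path x y), (∀ t, ω t ∉ A) → Q (.mk ω) := by
    intro x y ω hω
    obtain ⟨δ, hδ⟩ := h.exists_lift_of_forall_notMem (ω : C(I, X)) hω
    exact hΦ' ω δ hδ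
  induction c using Homotopic.Quotient.ind with | mk ω =>
  obtain ⟨a, ha0, hamono, ⟨N, hN⟩, ha⟩ := exists_monotone_Icc_subset_open_cover_unitInterval
    (c := fun b : Bool => ω ⁻¹' (if b then S else A)ᶜ)
    (fun b => by
      refine IsOpen.preimage ω.continuous ?_
      cases b
      · exact h.isClosed.isOpen_compl
      · exact hS.isOpen_compl)
    (fun t _ => by
      by_cases ht : ω t ∈ A
      · refine Set.mem_iUnion.2 ⟨true, ?_⟩
        rintro ⟨d, hd, hdt⟩
        have hd' : ‖(d : Fin n → ℝ)‖ ≤ 1 / 2 := hd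
        exact h.notMem_of_norm_lt_one d (by linarith) (hdt ▸ ht)
      · exact Set.mem_iUnion.2 ⟨false, ht⟩)
  have hpiece : ∀ m, Q (.mk (ω.subpath (a m) (a (m + 1)))) := by
    intro m
    have hrange : ∀ t, ∃ u ∈ Set.Icc (a m) (a (m + 1)), ω.subpath (a m) (a (m + 1)) t = ω u := by
      intro t
      have ht : ω.subpath (a m) (a (m + 1)) t ∈ ω '' Set.Icc (a m) (a (m + 1)) := by
        rw [← ω.range_subpath_of_le _ _ (hamono m.le_succ)]
        exact ⟨t, rfl⟩
      obtain ⟨u, hu, hut⟩ := ht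
      exact ⟨u, hu, hut.symm⟩
    obtain ⟨b, hb⟩ := ha m
    cases b
    · refine hinner _ fun t => ?_
      obtain ⟨u, hu, hut⟩ := hrange t
      rw [hut]
      exact hb hu
    · refine houter _ fun t => ?_
      obtain ⟨u, hu, hut⟩ := hrange t
      rw [hut]
      exact hb hu
  have hinit : ∀ m, Q (.mk (ω.subpath (a 0) (a m))) := by
    intro m
    induction m with
    | zero =>
      have := htrans _ _ (hpiece 0) (hsymm _ (hpiece 0))
      rw [Homotopic.Quotient.trans_symm] at this
      rwa [Path.subpath_self]
    | succ m ih =>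
      have := htrans _ _ ih (hpiece m)
      rwa [← Homotopic.Quotient.mk_trans,
        Homotopic.Quotient.eq.2 ⟨Path.Homotopy.subpathTransSubpath ω _ _ _⟩] at this
  refine hcongr _ ω (fun t => ?_) (hinit N)
  rw [ha0, hN N le_rfl, Path.subpath_zero_one]
  rfl

end IsCellAttachment

end CellAttachment

/-! ### Marked partial sections and their extension over a cell -/

section PartialSections

open unitInterval

open Path

variable {E B F : Type*} [TopologicalSpace E] [TopologicalSpace B] [TopologicalSpace F]

/-- A set of classes of loops at `e` that is a subgroup of the fundamental group of `E` mapped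
bijectively by `p` to the fundamental group of `B`. -/
structure IsSplitting (p : C(E, B)) {e : E} (Λ : Set (Homotopic.Quotient e e)) : Prop where
  refl_mem : Homotopic.Quotient.refl e ∈ Λ
  trans_mem : ∀ {c c'}, c ∈ Λ → c' ∈ Λ → c.trans c' ∈ Λ
  symm_mem : ∀ {c}, c ∈ Λ → c.symm ∈ Λ
  surjective : ∀ c : Homotopic.Quotient (p e) (p e), ∃ l ∈ Λ, l.map p = c
  injective : ∀ l ∈ Λ, l.map p = .refl (p e) → l = .refl e

/-- Continuing the path class `κ` by `c` gives `κ'`, up to a loop in `Λ`. -/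
def TransportsTo {e : E} (Λ : Set (Homotopic.Quotient e e)) {x y : E} (κ : Homotopic.Quotient e x)
    (c : Homotopic.Quotient x y) (κ' : Homotopic.Quotient e y) : Prop :=
  (κ.trans c).trans κ'.symm ∈ Λ

namespace IsSplitting

variable {p : C(E, B)} {e : E} {Λ : Set (Homotopic.Quotient e e)} {x y z : E}
  {κ : Homotopic.Quotient e x} {κ' : Homotopic.Quotient e y} {κ'' : Homotopic.Quotient e z}

theorem transportsTo_refl (h : IsSplitting p Λ) : TransportsTo Λ κ (.refl x) κ := by
  simpa [TransportsTo] using h.refl_mem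

theorem transportsTo_trans (h : IsSplitting p Λ) {c : Homotopic.Quotient x y}
    {c' : Homotopic.Quotient y z} (h₁ : TransportsTo Λ κ c κ') (h₂ : TransportsTo Λ κ' c' κ'') :
    TransportsTo Λ κ (c.trans c') κ'' := by
  simpa [TransportsTo] using h.trans_mem h₁ h₂

theorem transportsTo_symm (h : IsSplitting p Λ) {c : Homotopic.Quotient x y}
    (h₁ : TransportsTo Λ κ c κ') : TransportsTo Λ κ' c.symm κ := by
  simpa [TransportsTo] using h.symm_mem h₁

theorem transportsTo_self_trans (h : IsSplitting p Λ) (c : Homotopic.Quotient x y) :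
    TransportsTo Λ κ c (κ.trans c) := by
  simpa [TransportsTo] using h.refl_mem

/-- The loop κ · c · c'⁻¹ · κ⁻¹ lies in Λ and has trivial projection, so it is trivial. This is
where injectivity of `p` on Λ enters. -/
theorem eq_of_transportsTo (h : IsSplitting p Λ) {c c' : Homotopic.Quotient x y}
    (h₁ : TransportsTo Λ κ c κ') (h₂ : TransportsTo Λ κ c' κ') (hp : c.map p = c'.map p) :
    c = c' := by
  have h₃ := h.transportsTo_trans h₁ (h.transportsTo_symm h₂)
  have := h.injective _ h₃ (by
    simp only [Homotopic.Quotient.map_trans, Homotopic.Quotient.map_symm, hp,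
      Homotopic.Quotient.trans_symm, Homotopic.Quotient.trans_refl])
  have h4 : κ.trans (c.trans c'.symm) = κ.trans (.refl x) := by
    refine Homotopic.Quotient.trans_right_cancel (δ := κ.symm) ?_
    simpa using this
  have h5 := Homotopic.Quotient.trans_left_cancel h4
  refine Homotopic.Quotient.trans_right_cancel (δ := c'.symm) ?_
  rw [h5, Homotopic.Quotient.trans_symm]

/-- Every path in the base has a lift with prescribed end points and prescribed class modulo
the splitting. -/
theorem exists_lift_transportsTo (h : IsSplitting p Λ) (hp : IsFibreBundle F p)
    (κ : Homotopic.Quotient e x) (κ' : Homotopic.Quotient e y) (ω : Path (p x) (p y)) :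
    ∃ g : Path x y, (∀ t, p (g t) = ω t) ∧ TransportsTo Λ κ (.mk g) κ' := by
  -- Here l ∈ Λ projects to p(κ) · ω · p(κ')⁻¹, so κ⁻¹ · l · κ' projects to the class of ω and is
  -- represented by a lift of ω.
  obtain ⟨l, hl, hlp⟩ := h.surjective (((κ.map p).trans (.mk ω)).trans (κ'.map p).symm)
  obtain ⟨g, hg, hgc⟩ := hp.exists_lift_of_mk_map_eq ((κ.symm.trans l).trans κ') ω (by
    simp [Homotopic.Quotient.map_trans, Homotopic.Quotient.map_symm, hlp])
  exact ⟨g, hg, by simpa [TransportsTo, hgc] using hl⟩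

end IsSplitting

theorem transportsTo_congr {e : E} {Λ : Set (Homotopic.Quotient e e)}
    {σ₁ σ₁' σ₂ σ₂' : Σ y, Path e y}
    (h₁ : σ₁ = σ₁') (h₂ : σ₂ = σ₂') {η : Path σ₁.1 σ₂.1} {η' : Path σ₁'.1 σ₂'.1}
    (h : ∀ t, η t = η' t) (hη : TransportsTo Λ (.mk σ₁.2) (.mk η) (.mk σ₂.2)) :
    TransportsTo Λ (.mk σ₁'.2) (.mk η') (.mk σ₂'.2) := by
  subst h₁ h₂
  rwa [← Homotopic.Quotient.mk_eq_mk_of_forall h]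

/-- A section of `p` over `A ⊆ B` together with a choice of paths in `E` from the base point to its
values, such that the paths in the image of the section respect this choice up to `Λ`. -/
structure PartialSection (p : C(E, B)) {e : E} (Λ : Set (Homotopic.Quotient e e)) (A : Set B) where
  /-- The values of the section, with paths from the base point to them. -/
  toFun : B → Σ y : E, Path e y
  continuous_fst : Continuous fun a : A => (toFun a).1
  proj : ∀ a ∈ A, p (toFun a).1 = a
  transportsTo : ∀ {x y : A} (ω : Path x y),
    TransportsTo Λ (.mk (toFun x).2) (.mk (ω.map continuous_fst)) (.mk (toFun y).2)
  base : p e ∈ A → ∃ γ : Path e e, .mk γ ∈ Λ ∧ toFun (p e) = ⟨e, γ⟩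

instance (n : ℕ) : ContractibleSpace (ModelCell n) :=
  (convex_closedBall (0 : Fin n → ℝ) 1).contractibleSpace ⟨0, by simp⟩

variable {p : C(E, B)} {e : E} {Λ : Set (Homotopic.Quotient e e)} {A : Set B} {n : ℕ}

/-- The map `g` on the model cell extends the partial section `S` over a cell with characteristic
map `Φ`, where the path `κ₀` from the base point to `g d₀` is compatible with those of `S`. -/
structure IsCellExtension (S : PartialSection p Λ A) (Φ : C(ModelCell n, B)) (g : C(ModelCell n, E))
    (d₀ : ModelCell n) (κ₀ : Path e (g d₀)) : Prop where
  proj : ∀ d, p (g d) = Φ d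
  transportsTo : ∀ d : ModelCell n, ‖(d : Fin n → ℝ)‖ = 1 → ∃ κ : Path e (g d),
    S.toFun (Φ d) = ⟨g d, κ⟩ ∧
      ∀ δ : Path d₀ d, TransportsTo Λ (.mk κ₀) (.mk (δ.map g.continuous)) (.mk κ)

/-- An interior point d is marked by κ₀ followed by the image of a path from d₀ to d; modulo
homotopy the path does not matter, as the ball is simply connected. The invariant then holds for
paths in A and for paths in the cell, which generate. -/
theorem IsCellExtension.exists_partialSection [T2Space B] (hΛ : IsSplitting p Λ)
    {S : PartialSection p Λ A} {Φ : C(ModelCell n, B)} {g : C(ModelCell n, E)} {d₀ : ModelCell n}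
    {κ₀ : Path e (g d₀)} (hg : IsCellExtension S Φ g d₀ κ₀) (hA : IsClosed A)
    (hsph : ∀ d : ModelCell n, ‖(d : Fin n → ℝ)‖ = 1 → Φ d ∈ A)
    (hball : ∀ d : ModelCell n, ‖(d : Fin n → ℝ)‖ < 1 → Φ d ∉ A)
    (hinj : ∀ d d' : ModelCell n, ‖(d : Fin n → ℝ)‖ < 1 → Φ d = Φ d' → d = d')
    (hbase : ∀ d : ModelCell n, ‖(d : Fin n → ℝ)‖ < 1 → Φ d = p e →
      ∃ γ : Path e e, .mk γ ∈ Λ ∧ ∃ δ : Path d₀ d,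
        (⟨g d, κ₀.trans (δ.map g.continuous)⟩ : Σ y, Path e y) = ⟨e, γ⟩) :
    Nonempty (PartialSection p Λ (A ∪ Set.range Φ)) := by
  classical
  -- Over the base point the path must be the one supplied by `hbase`, so that the marking there is
  -- a loop in Λ; elsewhere any path serves.
  have hδ : ∀ d : ModelCell n, ∃ δ : Path d₀ d, ‖(d : Fin n → ℝ)‖ < 1 → Φ d = p e →
      ∃ γ : Path e e, .mk γ ∈ Λ ∧
        (⟨g d, κ₀.trans (δ.map g.continuous)⟩ : Σ y, Path e y) = ⟨e, γ⟩ := by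
    intro d
    by_cases hd : ‖(d : Fin n → ℝ)‖ < 1 ∧ Φ d = p e
    · obtain ⟨γ, hγ, δ, hδ⟩ := hbase d hd.1 hd.2
      exact ⟨δ, fun _ _ => ⟨γ, hγ, hδ⟩⟩
    · exact ⟨PathConnectedSpace.somePath _ _, fun h h' => absurd ⟨h, h'⟩ hd⟩
  choose δ hδ using hδ
  let ρ : ModelCell n → Σ y, Path e y := fun d => ⟨g d, κ₀.trans ((δ d).map g.continuous)⟩
  let q : B → Σ y, Path e y := fun x =>
    if x ∈ A then S.toFun x else if h : x ∈ Set.range Φ then ρ h.choose else S.toFun x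
  have hqA : ∀ x ∈ A, q x = S.toFun x := fun x hx => if_pos hx
  have hqΦ : ∀ d : ModelCell n, ‖(d : Fin n → ℝ)‖ < 1 → q (Φ d) = ρ d := by
    intro d hd
    have hr : Φ d ∈ Set.range Φ := ⟨d, rfl⟩
    simp only [q]
    rw [if_neg (hball d hd), dif_pos hr]
    exact congrArg ρ (hinj d _ hd hr.choose_spec.symm).symm
  have hqrel : ∀ d : ModelCell n, ∃ κ : Path e (g d), q (Φ d) = ⟨g d, κ⟩ ∧
      ∀ δ : Path d₀ d, TransportsTo Λ (.mk κ₀) (.mk (δ.map g.continuous)) (.mk κ) := by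
    intro d
    rcases (norm_le_one_of_closedBall d).lt_or_eq with hd | hd
    · refine ⟨_, hqΦ d hd, fun δ' => ?_⟩
      rw [Homotopic.Quotient.mk_trans]
      have : Homotopic.Quotient.mk (δ'.map g.continuous) = .mk ((δ d).map g.continuous) :=
        Homotopic.Quotient.eq.2 ((SimplyConnectedSpace.paths_homotopic δ' (δ d)).map g)
      rw [this]
      exact hΛ.transportsTo_self_trans _
    · rw [hqA _ (hsph d hd)]
      exact hg.transportsTo d hd
  let X : Set B := A ∪ Set.range Φ
  let ΦX : C(ModelCell n, X) := ⟨fun d => ⟨Φ d, Or.inr ⟨d, rfl⟩⟩, by fun_prop⟩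
  have hX : IsCellAttachment (Subtype.val ⁻¹' A : Set X) ΦX :=
    { isClosed := hA.preimage continuous_subtype_val
      cover := by
        rintro ⟨x, hx | ⟨d, rfl⟩⟩
        · exact Or.inl hx
        · exact Or.inr ⟨d, rfl⟩
      mem_of_norm_eq_one := hsph
      notMem_of_norm_lt_one := hball
      injective := fun d d' hd h => hinj d d' hd (congrArg Subtype.val h) }
  have hcont : Continuous fun a : X => (q a).1 := by
    have hval : IsClosedMap (Subtype.val : (Subtype.val ⁻¹' A : Set X) → X) :=
      hX.isClosed.isClosedMap_subtype_val
    refine continuous_of_isClosedMap_cover hval (v := ΦX) ΦX.continuous.isClosedMap ?_ ?_ ?_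
    · intro x
      rcases hX.cover x with h | h
      · exact Or.inl ⟨⟨x, h⟩, rfl⟩
      · exact Or.inr h
    · have : (fun a : X => (q a).1) ∘ (Subtype.val : (Subtype.val ⁻¹' A : Set X) → X) =
          (fun a : A => (S.toFun a).1) ∘ fun z => ⟨z.1.1, z.2⟩ :=
        funext fun z => congrArg Sigma.fst (hqA _ z.2)
      rw [this]
      exact S.continuous_fst.comp (by fun_prop)
    · have : (fun a : X => (q a).1) ∘ ΦX = g := funext fun d => by
        obtain ⟨κ, hκ, -⟩ := hqrel d
        exact congrArg Sigma.fst hκ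
      rw [this]
      exact g.continuous
  let s : C(X, E) := ⟨fun a => (q a).1, hcont⟩
  refine ⟨⟨q, hcont, ?_, ?_, ?_⟩⟩
  · rintro x (hx | ⟨d, rfl⟩)
    · rw [hqA x hx]
      exact S.proj x hx
    · obtain ⟨κ, hκ, -⟩ := hqrel d
      rw [hκ]
      exact hg.proj d
  · intro x y ω
    refine hX.induction_on_path_class (Q := fun {x y} c => TransportsTo Λ (.mk (q x).2)
      (c.map s) (.mk (q y).2)) ?_ ?_ ?_ ?_ (Homotopic.Quotient.mk ω)
    · intro x y z c c' h₁ h₂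
      rw [Homotopic.Quotient.map_trans]
      exact hΛ.transportsTo_trans h₁ h₂
    · intro x y c h₁
      rw [Homotopic.Quotient.map_symm]
      exact hΛ.transportsTo_symm h₁
    · intro x y ω hω
      have hx : (x : B) ∈ A := by simpa using hω 0
      have hy : (y : B) ∈ A := by simpa using hω 1
      let ω' : Path (⟨x, hx⟩ : A) ⟨y, hy⟩ :=
        ⟨⟨fun t => ⟨ω t, hω t⟩, by fun_prop⟩, Subtype.ext (by simp), Subtype.ext (by simp)⟩
      refine transportsTo_congr (hqA x hx).symm (hqA y hy).symm (fun t => ?_) (S.transportsTo ω')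
      exact congrArg Sigma.fst (hqA _ (hω t)).symm
    · intro d d' γ
      obtain ⟨κ, hκ, h₁⟩ := hqrel d
      obtain ⟨κ', hκ', h₂⟩ := hqrel d'
      have h₃ := hΛ.transportsTo_trans (hΛ.transportsTo_symm (h₁ (δ d))) (h₂ ((δ d).trans γ))
      rw [Path.map_trans, Homotopic.Quotient.mk_trans,
        Homotopic.Quotient.symm_trans_trans] at h₃
      refine transportsTo_congr (σ₁ := ⟨g d, κ⟩) (σ₂ := ⟨g d', κ'⟩) hκ.symm hκ'.symm
        (fun t => ?_) h₃
      obtain ⟨κt, hκt, -⟩ := hqrel (γ t)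
      exact (congrArg Sigma.fst hκt).symm
  · intro hb
    by_cases hbA : p e ∈ A
    · rw [hqA _ hbA]
      exact S.base hbA
    · obtain ⟨d, hd⟩ := hb.resolve_left hbA
      have hlt : ‖(d : Fin n → ℝ)‖ < 1 := (norm_le_one_of_closedBall d).lt_of_ne fun hc =>
        hbA (hd ▸ hsph d hc)
      obtain ⟨γ, hγ, hγ'⟩ := hδ d hlt hd
      exact ⟨γ, hγ, by rw [← hd, hqΦ d hlt]; exact hγ'⟩

end PartialSections

/-! ### Prescribing the value at a base point inside a cell -/

section BasePoint

open unitInterval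

open Path

variable {E B F Y : Type*} [TopologicalSpace E] [TopologicalSpace B] [TopologicalSpace F]
  [TopologicalSpace Y] {n : ℕ}

/-- A map on a ball can be deformed relative to the boundary so that its value at an interior point
moves along a given path. -/
theorem exists_homotopy_along_path (f : C(ModelCell n, Y)) (x₀ : ModelCell n)
    (hx₀ : ‖(x₀ : Fin n → ℝ)‖ < 1) {y : Y} (μ : Path (f x₀) y) :
    ∃ G : C(I × ModelCell n, Y), (∀ d, G (0, d) = f d) ∧
      (∀ t (d : ModelCell n), ‖(d : Fin n → ℝ)‖ = 1 → G (t, d) = f d) ∧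
      ∀ t : I, G (t, x₀) = μ (Set.projIcc 0 1 zero_le_one (2 * (t : ℝ) - 1)) := by
  set ε : ℝ := 1 - ‖(x₀ : Fin n → ℝ)‖ with hε
  have hε0 : 0 < ε := by linarith
  -- A bump at x₀, supported within distance ε and hence zero on the unit sphere. While v ≤ 1 the
  -- argument of f is dragged from d to x₀; for v between 1 and 2 the value runs along μ. At x₀
  -- itself v = 2t.
  let v : I × ModelCell n → ℝ := fun q =>
    2 * ((q.1 : ℝ) * max 0 (1 - ‖(q.2 : Fin n → ℝ) - x₀‖ / ε))
  have hv : Continuous v := by fun_prop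
  have hv0 : ∀ q, 0 ≤ v q := fun q =>
    mul_nonneg zero_le_two (mul_nonneg q.1.2.1 (le_max_left _ _))
  have hmem : ∀ q : I × ModelCell n, min 1 (v q) • (x₀ : Fin n → ℝ) +
      (1 - min 1 (v q)) • (q.2 : Fin n → ℝ) ∈ Metric.closedBall (0 : Fin n → ℝ) 1 := fun q =>
    convex_closedBall _ _ x₀.2 q.2.2 (le_min zero_le_one (hv0 q))
      (sub_nonneg.2 (min_le_left _ _)) (by ring)
  let G : I × ModelCell n → Y := fun q =>
    if v q ≤ 1 then f ⟨_, hmem q⟩ else μ (Set.projIcc 0 1 zero_le_one (v q - 1))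
  have hG : Continuous G := by
    refine Continuous.if_le (f.continuous.comp (by fun_prop))
      (μ.continuous.comp (continuous_projIcc.comp (by fun_prop))) hv continuous_const ?_
    intro q hq
    have h1 : Set.projIcc (0 : ℝ) 1 zero_le_one (v q - 1) = 0 := by
      rw [hq, sub_self]
      exact Set.projIcc_left _
    rw [h1, μ.source]
    congr 1
    exact Subtype.ext (by simp [hq])
  have hG0 : ∀ q, v q = 0 → G q = f q.2 := by
    intro q hq
    simp only [G]
    rw [if_pos (by linarith)]
    congr 1
    exact Subtype.ext (by simp [hq])
  refine ⟨⟨G, hG⟩, fun d => hG0 _ (by simp [v]), fun t d hd => hG0 _ ?_, fun t => ?_⟩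
  · have h1 : ε ≤ ‖(d : Fin n → ℝ) - x₀‖ := by
      have := norm_sub_norm_le (d : Fin n → ℝ) x₀
      rw [hd] at this
      linarith
    have h2 : 1 - ‖(d : Fin n → ℝ) - x₀‖ / ε ≤ 0 := by
      rw [sub_nonpos, one_le_div hε0]
      exact h1
    simp [v, max_eq_left h2]
  · have hvt : v (t, x₀) = 2 * (t : ℝ) := by simp [v]
    simp only [ContinuousMap.coe_mk, G]
    split_ifs with h
    · have h1 : Set.projIcc (0 : ℝ) 1 zero_le_one (2 * (t : ℝ) - 1) = 0 :=
        Set.projIcc_of_le_left _ (by linarith)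
      rw [h1, μ.source]
      congr 1
      refine Subtype.ext ?_
      simp only
      rw [← add_smul, add_sub_cancel, one_smul]
    · rw [hvt]

namespace Path.Homotopic.Quotient

theorem mk_cast_eq_trans_of_const {x y y' : Y} (κ : Path x y) (h : y' = y) (τ : Path y y')
    (hτ : ∀ t, τ t = y) : mk (κ.cast rfl h) = (mk κ).trans (mk τ) := by
  subst h
  rw [mk_eq_refl_of_forall hτ, trans_refl]
  rfl

theorem trans_mk_cast {x y z z' : Y} (c : Homotopic.Quotient x y) (τ : Path y z) (h : z' = z) :
    c.trans (mk (τ.cast rfl h)) = (c.trans (mk τ)).cast rfl h := by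
  subst h
  simp

end Path.Homotopic.Quotient

theorem sigma_mk_eq_cast {x y y' : Y} (κ : Path x y) (h : y' = y) :
    (⟨y, κ⟩ : Σ y, Path x y) = ⟨y', κ.cast rfl h⟩ := by
  subst h
  rfl

variable {p : C(E, B)} {e : E} {Λ : Set (Homotopic.Quotient e e)} {A : Set B}
  {S : PartialSection p Λ A} {Φ : C(ModelCell n, B)} {g : C(ModelCell n, E)}
  {d₀ : ModelCell n} {κ₀ : Path e (g d₀)}

/-- The fibre over `p e` contains a path μ from `g x₀` to e for which κ₀ · g(δ₀) · μ lies in Λ.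
Moving the fibre coordinate of g along μ, relative to the boundary, gives the value e at x₀ with a
marking in Λ, and the tracks of the homotopy carry the transport conditions from g to g'. -/
theorem IsCellExtension.exists_eq_base (hg : IsCellExtension S Φ g d₀ κ₀) (hΛ : IsSplitting p Λ)
    (hp : IsFibreBundle F p) (T : TrivAlong F p Φ Set.univ) (x₀ : ModelCell n)
    (hx₀ : ‖(x₀ : Fin n → ℝ)‖ < 1) (hb : Φ x₀ = p e) :
    ∃ (g' : C(ModelCell n, E)) (κ₀' : Path e (g' d₀)), IsCellExtension S Φ g' d₀ κ₀' ∧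
      ∃ γ : Path e e, .mk γ ∈ Λ ∧ ∃ δ : Path d₀ x₀,
        (⟨g' x₀, κ₀'.trans (δ.map g'.continuous)⟩ : Σ y, Path e y) = ⟨e, γ⟩ := by
  have hgx : p (g x₀) = p e := (hg.proj x₀).trans hb
  let δ₀ : Path d₀ x₀ := PathConnectedSpace.somePath d₀ x₀
  obtain ⟨μ, hμ, hμΛ⟩ := hΛ.exists_lift_transportsTo hp
    ((Homotopic.Quotient.mk κ₀).trans (.mk (δ₀.map g.continuous))) (.refl e)
    ((Path.refl (p e)).cast hgx rfl)
  replace hμ : ∀ t, p (μ t) = Φ x₀ := fun t => (hμ t).trans hb.symm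
  let f : C(ModelCell n, F) :=
    ⟨fun d => T.coord (d, g d), T.continuous_coord continuous_id g.continuous hg.proj⟩
  let μF : Path (f x₀) (T.coord (x₀, e)) := ⟨⟨fun t => T.coord (x₀, μ t),
    T.continuous_coord continuous_const μ.continuous hμ⟩, by simp [f], by simp⟩
  obtain ⟨GF, hGF0, hGF1, hGFx⟩ := exists_homotopy_along_path f x₀ hx₀ μF
  let G : C(I × ModelCell n, E) :=
    ⟨fun q => T.point (q.2, GF q), T.continuous_point.comp (by fun_prop)⟩
  have hpt : ∀ d, T.point (d, f d) = g d := fun d => T.point_coord d trivial _ (hg.proj d)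
  have hG0 : ∀ d, G (0, d) = g d := fun d => by
    simp only [G, ContinuousMap.coe_mk, hGF0, hpt]
  have hG1 : ∀ t (d : ModelCell n), ‖(d : Fin n → ℝ)‖ = 1 → G (t, d) = g d := fun t d hd => by
    simp only [G, ContinuousMap.coe_mk, hGF1 t d hd, hpt]
  have hGx : ∀ t : I, G (t, x₀) = μ (Set.projIcc 0 1 zero_le_one (2 * (t : ℝ) - 1)) := fun t => by
    simp only [G, ContinuousMap.coe_mk, hGFx]
    exact T.point_coord x₀ trivial _ (hμ _)
  let g' : C(ModelCell n, E) := ⟨fun d => G (1, d), by fun_prop⟩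
  let track : ∀ d, Path (g d) (g' d) := fun d => ⟨⟨fun t => G (t, d), by fun_prop⟩, hG0 d, rfl⟩
  have hsq : ∀ {d} (δ : Path d₀ d), (Homotopic.Quotient.mk (δ.map g.continuous)).trans
      (.mk (track d)) = (Homotopic.Quotient.mk (track d₀)).trans (.mk (δ.map g'.continuous)) := by
    intro d δ
    exact Homotopic.Quotient.mk_trans_eq_of_square ⟨fun q => G (q.2, δ q.1), by fun_prop⟩ _ _ _ _
      (fun s => hG0 _) (fun t => congrArg (fun z => G (t, z)) δ.target)
      (fun t => congrArg (fun z => G (t, z)) δ.source) (fun s => rfl)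
  have hg'x : g' x₀ = e := by
    have h1 : Set.projIcc (0 : ℝ) 1 zero_le_one (2 * ((1 : I) : ℝ) - 1) = 1 :=
      Set.projIcc_of_right_le _ (by norm_num)
    exact (hGx 1).trans (by rw [h1, μ.target])
  refine ⟨g', κ₀.trans (track d₀), ⟨fun d => T.proj_point d trivial _, fun d hd => ?_⟩,
    ((κ₀.trans (track d₀)).trans (δ₀.map g'.continuous)).cast rfl hg'x.symm, ?_, δ₀,
    sigma_mk_eq_cast _ _⟩
  · obtain ⟨κ, hκ, hκΛ⟩ := hg.transportsTo d hd
    have hgd : g' d = g d := hG1 1 d hd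
    refine ⟨κ.cast rfl hgd, hκ.trans (sigma_mk_eq_cast _ _), fun δ => ?_⟩
    rw [Homotopic.Quotient.mk_cast_eq_trans_of_const κ hgd (track d) fun t => hG1 t d hd]
    have := hκΛ δ
    unfold TransportsTo at this ⊢
    rw [Homotopic.Quotient.mk_trans, Homotopic.Quotient.trans_assoc (.mk κ₀), ← hsq δ]
    simpa using this
  -- The track of x₀ waits until time 1/2 and then follows μ, so it is a reparametrization of μ.
  · have hτ : Homotopic.Quotient.mk ((track x₀).cast rfl hg'x.symm) = .mk μ := by
      refine (Homotopic.Quotient.eq.2 ⟨(Path.Homotopy.reparam μ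
        (fun t => Set.projIcc 0 1 zero_le_one (2 * (t : ℝ) - 1))
        (continuous_projIcc.comp (by fun_prop)) (Set.projIcc_of_le_left _ (by norm_num))
        (Set.projIcc_of_right_le _ (by norm_num))).cast rfl ?_⟩).symm
      exact Path.ext (funext fun t => (hGx t).symm)
    rw [Homotopic.Quotient.mk_cast, Homotopic.Quotient.mk_trans, Homotopic.Quotient.mk_trans,
      Homotopic.Quotient.trans_assoc, ← hsq δ₀, ← Homotopic.Quotient.trans_assoc,
      ← Homotopic.Quotient.trans_mk_cast, hτ]
    simpa [TransportsTo] using hμΛ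

/-- A partial section that extends over a cell of positive dimension does so with the prescribed
value at the base point. -/
theorem IsCellExtension.exists_partialSection_of_trivAlong [T2Space B]
    (hg : IsCellExtension S Φ g d₀ κ₀) (hΛ : IsSplitting p Λ)
    (hp : IsFibreBundle F p) (T : TrivAlong F p Φ Set.univ) (hA : IsClosed A)
    (hsph : ∀ d : ModelCell n, ‖(d : Fin n → ℝ)‖ = 1 → Φ d ∈ A)
    (hball : ∀ d : ModelCell n, ‖(d : Fin n → ℝ)‖ < 1 → Φ d ∉ A)
    (hinj : ∀ d d' : ModelCell n, ‖(d : Fin n → ℝ)‖ < 1 → Φ d = Φ d' → d = d') :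
    Nonempty (PartialSection p Λ (A ∪ Set.range Φ)) := by
  by_cases h : ∃ x₀ : ModelCell n, ‖(x₀ : Fin n → ℝ)‖ < 1 ∧ Φ x₀ = p e
  · obtain ⟨x₀, hx₀, hb⟩ := h
    obtain ⟨g', κ₀', hg', γ, hγ, δ, hδ⟩ := hg.exists_eq_base hΛ hp T x₀ hx₀ hb
    refine hg'.exists_partialSection hΛ hA hsph hball hinj fun d hd hdb => ?_
    obtain rfl : d = x₀ := hinj d x₀ hd (hdb.trans hb.symm)
    exact ⟨γ, hγ, δ, hδ⟩
  · exact hg.exists_partialSection hΛ hA hsph hball hinj fun d hd hdb => absurd ⟨d, hd, hdb⟩ h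

end BasePoint

/-! ### Extension over cells of dimension 0, 1 and 2 -/

section LowDimensionalCells

open unitInterval

open Path

variable {E B F : Type*} [TopologicalSpace E] [TopologicalSpace B] [TopologicalSpace F]
  {p : C(E, B)} {e : E} {Λ : Set (Homotopic.Quotient e e)} {A : Set B}

/-- Since E may be disconnected, the value is the end of a lifted path starting at e, and that path
serves as marking. If the new vertex is the base point, e and the constant path are used instead. -/
theorem PartialSection.exists_extend_zero [T2Space B] [PathConnectedSpace B]
    (S : PartialSection p Λ A) (hΛ : IsSplitting p Λ) (hp : IsFibreBundle F p) (hA : IsClosed A)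
    (Φ : C(ModelCell 0, B)) (hball : ∀ d : ModelCell 0, Φ d ∉ A) :
    Nonempty (PartialSection p Λ (A ∪ Set.range Φ)) := by
  have hnorm : ∀ d : ModelCell 0, ‖(d : Fin 0 → ℝ)‖ = 0 := fun d => by
    rw [Subsingleton.elim (d : Fin 0 → ℝ) 0, norm_zero]
  have hsub : ∀ d d' : ModelCell 0, d = d' := fun d d' => Subtype.ext (Subsingleton.elim _ _)
  let d₀ : ModelCell 0 := ⟨0, by simp⟩
  obtain ⟨y, κ, hy, hbase⟩ : ∃ (y : E) (κ : Path e y), p y = Φ d₀ ∧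
      (Φ d₀ = p e → (⟨y, κ⟩ : Σ y, Path e y) = ⟨e, Path.refl e⟩) := by
    by_cases hb : Φ d₀ = p e
    · exact ⟨e, Path.refl e, hb.symm, fun _ => rfl⟩
    · obtain ⟨y, κ, hκ⟩ := hp.exists_path_lift (PathConnectedSpace.somePath (p e) (Φ d₀))
      exact ⟨y, κ, by simpa using hκ 1, fun h => absurd h hb⟩
  have hg : IsCellExtension S Φ (ContinuousMap.const _ y) d₀ κ :=
    ⟨fun d => by rw [hsub d d₀]; exact hy, fun d hd => by rw [hnorm d] at hd; norm_num at hd⟩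
  refine hg.exists_partialSection hΛ hA (fun d hd => by rw [hnorm d] at hd; norm_num at hd)
    (fun d _ => hball d) (fun d d' _ _ => hsub d d') fun d _ hd => ?_
  obtain rfl := hsub d d₀
  refine ⟨(Path.refl e).trans (Path.refl e), by simpa using hΛ.refl_mem, Path.refl _, ?_⟩
  have h := hbase hd
  have h' := congrArg
    (fun z : (Σ y, Path e y) => (⟨z.1, z.2.trans (Path.refl z.1)⟩ : Σ y, Path e y)) h
  exact h'

/-- The affine homeomorphism from the unit interval to the model of a `1`-cell. -/
def intervalToCell : C(I, ModelCell 1) where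
  toFun t := ⟨fun _ => 2 * (t : ℝ) - 1, by
    rw [mem_closedBall_zero_iff, pi_norm_le_iff_of_nonneg zero_le_one]
    intro _
    rw [Real.norm_eq_abs, abs_le]
    constructor <;> linarith [t.2.1, t.2.2]⟩
  continuous_toFun := by fun_prop

theorem abs_apply_le_one {n : ℕ} (d : ModelCell n) (i : Fin n) : |(d : Fin n → ℝ) i| ≤ 1 :=
  (norm_le_pi_norm (d : Fin n → ℝ) i).trans (norm_le_one_of_closedBall d)

theorem continuous_coe_apply {n : ℕ} (i : Fin n) :
    Continuous fun d : ModelCell n => (d : Fin n → ℝ) i :=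
  (continuous_apply i).comp continuous_subtype_val

theorem half_add_one_mem {n : ℕ} (d : ModelCell n) (i : Fin n) :
    ((d : Fin n → ℝ) i + 1) / 2 ∈ I := by
  have := abs_le.1 (abs_apply_le_one d i)
  constructor <;> linarith

/-- The inverse of `intervalToCell`. -/
noncomputable def cellToInterval : C(ModelCell 1, I) where
  toFun d := ⟨((d : Fin 1 → ℝ) 0 + 1) / 2, half_add_one_mem d 0⟩
  continuous_toFun := (((continuous_coe_apply 0).add continuous_const).div_const 2).subtype_mk _

theorem intervalToCell_cellToInterval (d : ModelCell 1) :
    intervalToCell (cellToInterval d) = d := by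
  refine Subtype.ext (funext fun i => ?_)
  rw [Subsingleton.elim i 0]
  change 2 * (((d : Fin 1 → ℝ) 0 + 1) / 2) - 1 = _
  ring

theorem cellToInterval_intervalToCell (t : I) : cellToInterval (intervalToCell t) = t :=
  Subtype.ext (by change (2 * (t : ℝ) - 1 + 1) / 2 = t; ring)

theorem eq_of_norm_eq_one_of_cell_one (d : ModelCell 1) (hd : ‖(d : Fin 1 → ℝ)‖ = 1) :
    d = intervalToCell 0 ∨ d = intervalToCell 1 := by
  have h : |(d : Fin 1 → ℝ) 0| = 1 := by
    refine Eq.trans ?_ hd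
    rw [← Real.norm_eq_abs]
    refine le_antisymm (norm_le_pi_norm _ _) ((pi_norm_le_iff_of_nonneg (norm_nonneg _)).2 ?_)
    intro i
    rw [Subsingleton.elim i 0]
  rcases eq_or_eq_neg_of_abs_eq h with h | h
  · right
    refine Subtype.ext (funext fun i => ?_)
    rw [Subsingleton.elim i 0, h]
    change (1 : ℝ) = 2 * ((1 : I) : ℝ) - 1
    norm_num
  · left
    refine Subtype.ext (funext fun i => ?_)
    rw [Subsingleton.elim i 0, h]
    change (-1 : ℝ) = 2 * ((0 : I) : ℝ) - 1
    norm_num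

theorem norm_intervalToCell_zero : ‖(intervalToCell 0 : Fin 1 → ℝ)‖ = 1 := by
  simp [intervalToCell, Pi.norm_def]

theorem norm_intervalToCell_one : ‖(intervalToCell 1 : Fin 1 → ℝ)‖ = 1 := by
  simp [intervalToCell, Pi.norm_def]; norm_num

/-- Surjectivity of Λ onto the fundamental group of B provides a lift of the edge that joins the
given end values and is compatible with their markings. -/
theorem PartialSection.exists_extend_one [T2Space B]
    (S : PartialSection p Λ A) (hΛ : IsSplitting p Λ) (hp : IsFibreBundle F p) (hA : IsClosed A)
    (Φ : C(ModelCell 1, B))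
    (hsph : ∀ d : ModelCell 1, ‖(d : Fin 1 → ℝ)‖ = 1 → Φ d ∈ A)
    (hball : ∀ d : ModelCell 1, ‖(d : Fin 1 → ℝ)‖ < 1 → Φ d ∉ A)
    (hinj : ∀ d d' : ModelCell 1, ‖(d : Fin 1 → ℝ)‖ < 1 → Φ d = Φ d' → d = d') :
    Nonempty (PartialSection p Λ (A ∪ Set.range Φ)) := by
  have h0 := S.proj _ (hsph _ norm_intervalToCell_zero)
  have h1 := S.proj _ (hsph _ norm_intervalToCell_one)
  let r : Path (intervalToCell 0) (intervalToCell 1) := ⟨intervalToCell, rfl, rfl⟩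
  obtain ⟨g₁, hg₁, hg₁Λ⟩ := hΛ.exists_lift_transportsTo hp
    (.mk (S.toFun (Φ (intervalToCell 0))).2) (.mk (S.toFun (Φ (intervalToCell 1))).2)
    ((r.map Φ.continuous).cast h0 h1)
  replace hg₁ : ∀ t, p (g₁ t) = Φ (intervalToCell t) := hg₁
  let g : C(ModelCell 1, E) := ⟨fun d => g₁ (cellToInterval d), by fun_prop⟩
  have hgr : ∀ t, g (intervalToCell t) = g₁ t := fun t =>
    congrArg g₁ (cellToInterval_intervalToCell t)
  have hg0 : g (intervalToCell 0) = (S.toFun (Φ (intervalToCell 0))).1 := by rw [hgr, g₁.source]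
  have hg1 : g (intervalToCell 1) = (S.toFun (Φ (intervalToCell 1))).1 := by rw [hgr, g₁.target]
  have hg : IsCellExtension S Φ g (intervalToCell 0)
      ((S.toFun (Φ (intervalToCell 0))).2.cast rfl hg0) := by
    refine ⟨fun d => ?_, fun d hd => ?_⟩
    · exact (hg₁ _).trans (by rw [intervalToCell_cellToInterval])
    rcases eq_of_norm_eq_one_of_cell_one d hd with rfl | rfl
    · refine ⟨(S.toFun (Φ (intervalToCell 0))).2.cast rfl hg0, sigma_mk_eq_cast _ _, fun δ => ?_⟩
      have : Homotopic.Quotient.mk (δ.map g.continuous) = .refl _ :=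
        Homotopic.Quotient.eq.2 ((SimplyConnectedSpace.paths_homotopic δ (Path.refl _)).map g)
      rw [this]
      exact hΛ.transportsTo_refl
    · refine ⟨(S.toFun (Φ (intervalToCell 1))).2.cast rfl hg1, sigma_mk_eq_cast _ _, fun δ => ?_⟩
      have : Homotopic.Quotient.mk (δ.map g.continuous) = .mk (r.map g.continuous) :=
        Homotopic.Quotient.eq.2 ((SimplyConnectedSpace.paths_homotopic δ r).map g)
      rw [this]
      exact transportsTo_congr (sigma_mk_eq_cast (S.toFun (Φ (intervalToCell 0))).2 hg0)
        (sigma_mk_eq_cast (S.toFun (Φ (intervalToCell 1))).2 hg1) (fun t => (hgr t).symm) hg₁Λ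
  obtain ⟨T⟩ := exists_trivAlong_of_retract hp Φ
    ⟨fun d => (cellToInterval d, 0), by fun_prop⟩ ⟨fun q => intervalToCell q.1, by fun_prop⟩
    intervalToCell_cellToInterval
  exact hg.exists_partialSection_of_trivAlong hΛ hp T hA hsph hball hinj

/-- The affine homeomorphism from the square to the model of a `2`-cell. -/
def squareToCell : C(I × I, ModelCell 2) where
  toFun q := ⟨![2 * (q.1 : ℝ) - 1, 2 * (q.2 : ℝ) - 1], by
    rw [mem_closedBall_zero_iff, pi_norm_le_iff_of_nonneg zero_le_one]
    intro i
    rw [Real.norm_eq_abs, abs_le]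
    fin_cases i
    · constructor <;> simp <;> linarith [q.1.2.1, q.1.2.2]
    · constructor <;> simp <;> linarith [q.2.2.1, q.2.2.2]⟩
  continuous_toFun := by
    refine Continuous.subtype_mk (continuous_pi fun i => ?_) _
    fin_cases i
    · simp only [Fin.zero_eta, Matrix.cons_val_zero]; fun_prop
    · simp only [Fin.mk_one, Matrix.cons_val_one, Matrix.cons_val_fin_one]; fun_prop

/-- The inverse of `squareToCell`. -/
noncomputable def cellToSquare : C(ModelCell 2, I × I) where
  toFun d := (⟨((d : Fin 2 → ℝ) 0 + 1) / 2, half_add_one_mem d 0⟩,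
    ⟨((d : Fin 2 → ℝ) 1 + 1) / 2, half_add_one_mem d 1⟩)
  continuous_toFun :=
    ((((continuous_coe_apply 0).add continuous_const).div_const 2).subtype_mk _).prodMk
      ((((continuous_coe_apply 1).add continuous_const).div_const 2).subtype_mk _)

theorem squareToCell_cellToSquare (d : ModelCell 2) : squareToCell (cellToSquare d) = d := by
  refine Subtype.ext (funext fun i => ?_)
  fin_cases i
  · change 2 * (((d : Fin 2 → ℝ) 0 + 1) / 2) - 1 = (d : Fin 2 → ℝ) 0
    ring
  · change 2 * (((d : Fin 2 → ℝ) 1 + 1) / 2) - 1 = (d : Fin 2 → ℝ) 1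
    ring

theorem norm_squareToCell_eq_one_iff (q : I × I) : ‖(squareToCell q : Fin 2 → ℝ)‖ = 1 ↔
    q.1 = 0 ∨ q.1 = 1 ∨ q.2 = 0 ∨ q.2 = 1 := by
  have h0 : (squareToCell q : Fin 2 → ℝ) 0 = 2 * (q.1 : ℝ) - 1 := rfl
  have h1 : (squareToCell q : Fin 2 → ℝ) 1 = 2 * (q.2 : ℝ) - 1 := rfl
  have habs : ∀ t : I, |2 * (t : ℝ) - 1| = 1 ↔ t = 0 ∨ t = 1 := by
    intro t
    rw [abs_eq zero_le_one, or_comm]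
    refine or_congr ⟨fun h => Subtype.ext ?_, fun h => ?_⟩ ⟨fun h => Subtype.ext ?_, fun h => ?_⟩
    · change (t : ℝ) = 0
      linarith
    · rw [h]; simp
    · change (t : ℝ) = 1
      linarith
    · rw [h]; norm_num
  rw [← or_assoc, ← habs, ← habs, ← h0, ← h1, ← Real.norm_eq_abs, ← Real.norm_eq_abs]
  have hle := norm_le_one_of_closedBall (squareToCell q)
  constructor
  · intro h
    by_contra! hc
    have hlt : ∀ i, ‖(squareToCell q : Fin 2 → ℝ) i‖ < 1 := by
      intro i
      refine lt_of_le_of_ne ((norm_le_pi_norm _ i).trans hle) ?_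
      fin_cases i
      · exact hc.1
      · exact hc.2
    have := (pi_norm_lt_iff one_pos).2 hlt
    linarith
  · rintro (h | h)
    · exact le_antisymm hle (h.symm.le.trans (norm_le_pi_norm _ _))
    · exact le_antisymm hle (h.symm.le.trans (norm_le_pi_norm _ _))

theorem exists_path_of_norm_eq_one {d d' : ModelCell 2} (hd : ‖(d : Fin 2 → ℝ)‖ = 1)
    (hd' : ‖(d' : Fin 2 → ℝ)‖ = 1) :
    ∃ δ : Path d d', ∀ t, ‖(δ t : Fin 2 → ℝ)‖ = 1 := by
  have hrank : 1 < Module.rank ℝ (Fin 2 → ℝ) := by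
    rw [rank_fin_fun]; norm_num
  obtain ⟨γ, hγ⟩ := (isPathConnected_sphere hrank (0 : Fin 2 → ℝ) zero_le_one).joinedIn
    d (by simpa using hd) d' (by simpa using hd')
  have hγ' : ∀ t, ‖γ t‖ = 1 := fun t => by simpa using hγ t
  exact ⟨⟨⟨fun t => ⟨γ t, by simp [hγ' t]⟩, by fun_prop⟩, Subtype.ext γ.source,
    Subtype.ext γ.target⟩, hγ'⟩

/-- In the sup norm the ball is a square. The two boundary routes between opposite corners lift to
paths with the same transport and, because Φ fills the square, the same projection, so they are
homotopic in E; π₁-injectivity of the fibre then fills the lift. -/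
theorem PartialSection.exists_extend_two [T2Space B]
    (S : PartialSection p Λ A) (hΛ : IsSplitting p Λ) (hp : IsFibreBundle F p)
    (hfib : FibreLoopsInject p e) (hA : IsClosed A) (Φ : C(ModelCell 2, B))
    (hsph : ∀ d : ModelCell 2, ‖(d : Fin 2 → ℝ)‖ = 1 → Φ d ∈ A)
    (hball : ∀ d : ModelCell 2, ‖(d : Fin 2 → ℝ)‖ < 1 → Φ d ∉ A)
    (hinj : ∀ d d' : ModelCell 2, ‖(d : Fin 2 → ℝ)‖ < 1 → Φ d = Φ d' → d = d') :
    Nonempty (PartialSection p Λ (A ∪ Set.range Φ)) := by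
  have hbd : ∀ q : I × I, (q.1 = 0 ∨ q.1 = 1 ∨ q.2 = 0 ∨ q.2 = 1) → Φ (squareToCell q) ∈ A :=
    fun q hq => hsph _ ((norm_squareToCell_eq_one_iff q).2 hq)
  let c : (q : I × I) → (q.1 = 0 ∨ q.1 = 1 ∨ q.2 = 0 ∨ q.2 = 1) → A := fun q hq =>
    ⟨Φ (squareToCell q), hbd q hq⟩
  let bot : Path (c (0, 0) (by simp)) (c (1, 0) (by simp)) :=
    ⟨⟨fun s => c (s, 0) (by simp), by fun_prop⟩, rfl, rfl⟩
  let top : Path (c (0, 1) (by simp)) (c (1, 1) (by simp)) :=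
    ⟨⟨fun s => c (s, 1) (by simp), by fun_prop⟩, rfl, rfl⟩
  let left : Path (c (0, 0) (by simp)) (c (0, 1) (by simp)) :=
    ⟨⟨fun s => c (0, s) (by simp), by fun_prop⟩, rfl, rfl⟩
  let right : Path (c (1, 0) (by simp)) (c (1, 1) (by simp)) :=
    ⟨⟨fun s => c (1, s) (by simp), by fun_prop⟩, rfl, rfl⟩
  have hproj : ∀ a : A, p (S.toFun a).1 = a := fun a => S.proj a a.2
  have hcomm : (Homotopic.Quotient.mk (bot.map S.continuous_fst)).trans
      (.mk (right.map S.continuous_fst)) =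
      (Homotopic.Quotient.mk (left.map S.continuous_fst)).trans
      (.mk (top.map S.continuous_fst)) := by
    refine hΛ.eq_of_transportsTo
      (hΛ.transportsTo_trans (S.transportsTo bot) (S.transportsTo right))
      (hΛ.transportsTo_trans (S.transportsTo left) (S.transportsTo top)) ?_
    rw [Homotopic.Quotient.map_trans, Homotopic.Quotient.map_trans]
    exact Homotopic.Quotient.mk_trans_eq_of_square (Φ.comp squareToCell)
      ((bot.map S.continuous_fst).map p.continuous) ((right.map S.continuous_fst).map p.continuous)
      ((left.map S.continuous_fst).map p.continuous) ((top.map S.continuous_fst).map p.continuous)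
      (fun s => (hproj (bot s)).symm) (fun s => (hproj (right s)).symm)
      (fun s => (hproj (left s)).symm) (fun s => (hproj (top s)).symm)
  obtain ⟨K, hKp, hKb, hKr, hKl, hKt⟩ := hp.exists_square_lift (Φ.comp squareToCell)
    (bot.map S.continuous_fst) (right.map S.continuous_fst) (left.map S.continuous_fst)
    (top.map S.continuous_fst) (fun s => hproj (bot s)) (fun s => hproj (right s))
    (fun s => hproj (left s)) (fun s => hproj (top s)) hcomm
    (hfib.of_path hp (S.toFun (c (0, 0) (by simp))).2)
  let g : C(ModelCell 2, E) := K.comp cellToSquare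
  have hK : ∀ q : I × I, (q.1 = 0 ∨ q.1 = 1 ∨ q.2 = 0 ∨ q.2 = 1) →
      K q = (S.toFun (Φ (squareToCell q))).1 := by
    rintro ⟨s, t⟩ (h | h | h | h) <;> dsimp only at h <;> subst h
    · exact hKl t
    · exact hKr t
    · exact hKb s
    · exact hKt s
  have hgs : ∀ d : ModelCell 2, ‖(d : Fin 2 → ℝ)‖ = 1 → g d = (S.toFun (Φ d)).1 := by
    intro d hd
    rw [← squareToCell_cellToSquare d] at hd
    have := hK _ ((norm_squareToCell_eq_one_iff _).1 hd)
    rwa [squareToCell_cellToSquare] at this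
  have hd₀ : ‖(squareToCell (0, 0) : Fin 2 → ℝ)‖ = 1 :=
    (norm_squareToCell_eq_one_iff _).2 (by simp)
  have hg : IsCellExtension S Φ g (squareToCell (0, 0))
      ((S.toFun (Φ (squareToCell (0, 0)))).2.cast rfl (hgs _ hd₀)) := by
    refine ⟨fun d => ?_, fun d hd => ⟨(S.toFun (Φ d)).2.cast rfl (hgs d hd), sigma_mk_eq_cast _ _,
      fun δ => ?_⟩⟩
    · exact (hKp _).trans (congrArg Φ (squareToCell_cellToSquare d))
    -- The invariant of S only concerns paths in A, so δ is replaced by a homotopic path along the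
    -- sphere.
    · obtain ⟨δ', hδ'⟩ := exists_path_of_norm_eq_one hd₀ hd
      have : Homotopic.Quotient.mk (δ.map g.continuous) = .mk (δ'.map g.continuous) :=
        Homotopic.Quotient.eq.2 ((SimplyConnectedSpace.paths_homotopic δ δ').map g)
      rw [this]
      let ω : Path (⟨Φ (squareToCell (0, 0)), hsph _ hd₀⟩ : A) ⟨Φ d, hsph _ hd⟩ :=
        ⟨⟨fun t => ⟨Φ (δ' t), hsph _ (hδ' t)⟩, by fun_prop⟩, Subtype.ext (by simp),
          Subtype.ext (by simp)⟩
      exact transportsTo_congr (sigma_mk_eq_cast (S.toFun (Φ (squareToCell (0, 0)))).2 (hgs _ hd₀))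
        (sigma_mk_eq_cast (S.toFun (Φ d)).2 (hgs d hd)) (fun t => (hgs _ (hδ' t)).symm)
        (S.transportsTo ω)
  obtain ⟨T⟩ := exists_trivAlong_of_retract hp Φ cellToSquare squareToCell
    squareToCell_cellToSquare
  exact hg.exists_partialSection_of_trivAlong hΛ hp T hA hsph hball hinj

end LowDimensionalCells

/-! ### Induction over the cells of a finite complex -/

section FiniteComplexes

open CWComplex Metric

/-- Induction over the cells of a finite CW complex in the order of their dimensions. -/
theorem CWComplex.induction_on_cells {B : Type*} [TopologicalSpace B] [T2Space B]
    [CWComplex (Set.univ : Set B)] (hfin : CWComplex.Finite (Set.univ : Set B))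
    {P : Set B → Prop} (empty : P ∅)
    (attach : ∀ (n : ℕ) (i : cell (Set.univ : Set B) n) (A : Set B), IsClosed A → P A →
      (∀ d : Fin n → ℝ, ‖d‖ = 1 → map n i d ∈ A) → (∀ d : Fin n → ℝ, ‖d‖ < 1 → map n i d ∉ A) →
      P (A ∪ closedCell n i)) : P Set.univ := by
  classical
  have : _root_.Finite (Σ n, cell (Set.univ : Set B) n) := finite_cells_of_finite (finite := hfin)
  have := Fintype.ofFinite (Σ n, cell (Set.univ : Set B) n)
  -- The sets of cells considered contain every cell of dimension below that of a member, so the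
  -- frontier of each new cell is already covered.
  have key : ∀ s : Finset (Σ n, cell (Set.univ : Set B) n),
      (∀ x ∈ s, ∀ y : Σ n, cell (Set.univ : Set B) n, y.1 < x.1 → y ∈ s) →
      P (⋃ x ∈ s, closedCell x.1 x.2) := by
    intro s
    refine Finset.induction_on_max_value (fun x : Σ n, cell (Set.univ : Set B) n => x.1) s ?_ ?_
    · simpa using empty
    · intro a s ha hmax ih hs
      have hlow : ∀ y : Σ n, cell (Set.univ : Set B) n, y.1 < a.1 → y ∈ s := by
        intro y hy
        refine (Finset.mem_insert.1 (hs a (Finset.mem_insert_self a s) y hy)).resolve_left ?_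
        rintro rfl
        exact lt_irrefl _ hy
      have hs' : ∀ x ∈ s, ∀ y : Σ n, cell (Set.univ : Set B) n, y.1 < x.1 → y ∈ s :=
        fun x hx y hy => hlow y (hy.trans_le (hmax x hx))
      have hunion : ⋃ x ∈ insert a s, closedCell x.1 x.2 =
          (⋃ x ∈ s, closedCell x.1 x.2) ∪ closedCell a.1 a.2 := by
        rw [Finset.set_biUnion_insert, Set.union_comm]
      have hfront : ∀ x : Σ n, cell (Set.univ : Set B) n, ∀ z ∈ cellFrontier x.1 x.2,
          ∃ y : Σ n, cell (Set.univ : Set B) n, y.1 < x.1 ∧ z ∈ openCell y.1 y.2 := by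
        intro x z hz
        obtain ⟨J, hJ⟩ := cellFrontier_subset_finite_openCell x.1 x.2
        have := hJ hz
        simp only [Set.mem_iUnion] at this
        obtain ⟨m, hm, j, -, hz⟩ := this
        exact ⟨⟨m, j⟩, hm, hz⟩
      rw [hunion]
      refine attach a.1 a.2 _ ?_ (ih hs') ?_ ?_
      · exact s.finite_toSet.isClosed_biUnion fun x _ => isClosed_closedCell
      · intro d hd
        obtain ⟨y, hy, hz⟩ := hfront a (map a.1 a.2 d) ⟨d, by simpa using hd, rfl⟩
        exact Set.mem_biUnion (hlow y hy) (openCell_subset_closedCell _ _ hz)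
      · intro d hd hmem
        have hopen : map a.1 a.2 d ∈ openCell a.1 a.2 := ⟨d, by simpa using hd, rfl⟩
        simp only [Set.mem_iUnion] at hmem
        obtain ⟨x, hx, hz⟩ := hmem
        rw [← cellFrontier_union_openCell_eq_closedCell] at hz
        -- A point of the earlier union lies in the open cell of some member of s, which is disjoint
        -- from the new open cell.
        obtain ⟨y, hy, hzy⟩ : ∃ y ∈ s, map a.1 a.2 d ∈ openCell y.1 y.2 := by
          rcases hz with hz | hz
          · obtain ⟨y, hy, hzy⟩ := hfront x _ hz
            exact ⟨y, hs' x hx y hy, hzy⟩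
          · exact ⟨x, hx, hz⟩
        have hne : (⟨a.1, a.2⟩ : Σ n, cell (Set.univ : Set B) n) ≠ ⟨y.1, y.2⟩ := fun h =>
          ha (by have h' : a = y := h; rwa [h'])
        exact Set.disjoint_left.1 (disjoint_openCell_of_ne hne) hopen hzy
  have h := key Finset.univ fun _ _ _ _ => Finset.mem_univ _
  have hU : ⋃ x ∈ (Finset.univ : Finset (Σ n, cell (Set.univ : Set B) n)),
      closedCell x.1 x.2 = (Set.univ : Set B) := by
    refine Eq.trans ?_ (CWComplex.union (C := (Set.univ : Set B)))
    ext z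
    simp only [Set.mem_iUnion, Finset.mem_univ, exists_const, Sigma.exists]
  rwa [hU] at h

end FiniteComplexes

/-! ### Sections and splittings -/

section Sections

open Path

variable {E B F : Type*} [TopologicalSpace E] [TopologicalSpace B] [TopologicalSpace F]

theorem PartialSection.exists_extend [T2Space B] [PathConnectedSpace B] {p : C(E, B)} {e : E}
    {Λ : Set (Homotopic.Quotient e e)} {A : Set B} (S : PartialSection p Λ A)
    (hΛ : IsSplitting p Λ) (hp : IsFibreBundle F p) (hfib : FibreLoopsInject p e) {n : ℕ}
    (hn : n ≤ 2) (hA : IsClosed A) (Φ : C(ModelCell n, B))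
    (hsph : ∀ d : ModelCell n, ‖(d : Fin n → ℝ)‖ = 1 → Φ d ∈ A)
    (hball : ∀ d : ModelCell n, ‖(d : Fin n → ℝ)‖ < 1 → Φ d ∉ A)
    (hinj : ∀ d d' : ModelCell n, ‖(d : Fin n → ℝ)‖ < 1 → Φ d = Φ d' → d = d') :
    Nonempty (PartialSection p Λ (A ∪ Set.range Φ)) := by
  match n, hn with
  | 0, _ =>
    refine S.exists_extend_zero hΛ hp hA Φ fun d => hball d ?_
    rw [Subsingleton.elim (d : Fin 0 → ℝ) 0, norm_zero]
    exact one_pos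
  | 1, _ => exact S.exists_extend_one hΛ hp hA Φ hsph hball hinj
  | 2, _ => exact S.exists_extend_two hΛ hp hfib hA Φ hsph hball hinj

theorem IsFinite2Complex.exists_partialSection [T2Space B] [PathConnectedSpace B]
    [CWComplex (Set.univ : Set B)] (hB : IsFinite2Complex B) {p : C(E, B)}
    (hp : IsFibreBundle F p) {e : E} {Λ : Set (Homotopic.Quotient e e)} (hΛ : IsSplitting p Λ)
    (hfib : FibreLoopsInject p e) : Nonempty (PartialSection p Λ Set.univ) := by
  refine CWComplex.induction_on_cells hB.finite
    (P := fun A => Nonempty (PartialSection p Λ A)) ?_ ?_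
  · exact ⟨⟨fun _ => ⟨e, Path.refl e⟩, continuous_const, fun a ha => ha.elim,
      fun {x} => x.2.elim, fun h => h.elim⟩⟩
  · rintro n i A hA ⟨S⟩ hsph hball
    let Φ : C(ModelCell n, B) := ⟨fun d => RelCWComplex.map n i d,
      (RelCWComplex.continuousOn n i).comp_continuous continuous_subtype_val fun d => d.2⟩
    have hrange : Set.range Φ = RelCWComplex.closedCell n i := by
      ext z
      constructor
      · rintro ⟨d, rfl⟩
        exact ⟨d, d.2, rfl⟩
      · rintro ⟨d, hd, rfl⟩
        exact ⟨⟨d, hd⟩, rfl⟩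
    have hinj : ∀ d d' : ModelCell n, ‖(d : Fin n → ℝ)‖ < 1 → Φ d = Φ d' → d = d' := by
      intro d d' hd h
      rcases (norm_le_one_of_closedBall d').lt_or_eq with hd' | hd'
      · refine Subtype.ext ((RelCWComplex.map n i).injOn ?_ ?_ h)
        · rw [RelCWComplex.source_eq]
          simpa using hd
        · rw [RelCWComplex.source_eq]
          simpa using hd'
      · exact absurd (h ▸ hsph d' hd' : Φ d ∈ A) (hball d hd)
    rw [← hrange]
    have hn : n ≤ 2 := not_lt.1 fun h => (hB.dim_le_two n h).false i
    exact S.exists_extend hΛ hp hfib hn hA Φ (fun d => hsph d) (fun d => hball d) hinj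

theorem isSplitting_range {p : C(E, B)} {e : E}
    (σ : FundamentalGroup B (p e) →* FundamentalGroup E e)
    (hσ : ∀ c : Homotopic.Quotient (p e) (p e), Homotopic.Quotient.map (σ c) p = c) :
    IsSplitting p (Set.range σ : Set (Homotopic.Quotient e e)) where
  refl_mem := ⟨1, map_one σ⟩
  trans_mem := by
    rintro _ _ ⟨a, rfl⟩ ⟨b, rfl⟩
    -- In the fundamental group `b * a` is the concatenation of a followed by b.
    exact ⟨b * a, map_mul σ b a⟩
  symm_mem := by
    rintro _ ⟨a, rfl⟩
    exact ⟨a⁻¹, map_inv σ a⟩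
  surjective c := ⟨σ c, ⟨c, rfl⟩, hσ c⟩
  injective := by
    rintro _ ⟨a, rfl⟩ h
    have : a = 1 := (hσ a).symm.trans h
    rw [this]
    exact map_one σ

theorem mapOfEq_rfl_comp_eq_id_iff {p : C(E, B)} {e : E}
    {σ : FundamentalGroup B (p e) →* FundamentalGroup E e} :
    (FundamentalGroup.mapOfEq p rfl).comp σ = MonoidHom.id (FundamentalGroup B (p e)) ↔
      ∀ c : Homotopic.Quotient (p e) (p e), Homotopic.Quotient.map (σ c) p = c := by
  rw [DFunLike.ext_iff]
  refine forall_congr' fun c => ?_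
  rw [MonoidHom.comp_apply, FundamentalGroup.mapOfEq_apply, Homotopic.Quotient.cast_rfl_rfl]
  rfl

theorem map_map_section {p : C(E, B)} {s : C(B, E)} (hs : ∀ b, p (s b) = b) {x y : B}
    (c : Homotopic.Quotient x y) : (c.map s).map p = c.cast (hs x) (hs y) := by
  induction c using Homotopic.Quotient.ind with | mk ω =>
  exact Homotopic.Quotient.mk_eq_mk_of_forall fun t => hs (ω t)

theorem exists_section_of_splitting [T2Space B] [PathConnectedSpace B]
    [CWComplex (Set.univ : Set B)] (hB : IsFinite2Complex B) {p : C(E, B)}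
    (hp : IsFibreBundle F p) {e : E} (hfib : FibreLoopsInject p e)
    (σ : FundamentalGroup B (p e) →* FundamentalGroup E e)
    (hσ : ∀ c : Homotopic.Quotient (p e) (p e), Homotopic.Quotient.map (σ c) p = c) :
    ∃ (s : C(B, E)) (hs : s (p e) = e), p.comp s = ContinuousMap.id B ∧
      FundamentalGroup.mapOfEq s hs = σ := by
  have hΛ := isSplitting_range σ hσ
  obtain ⟨S⟩ := hB.exists_partialSection hp hΛ hfib
  obtain ⟨γ, hγ, hbase⟩ := S.base trivial
  let s : C(B, E) := ⟨fun b => (S.toFun b).1, S.continuous_fst.comp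
    (continuous_id.subtype_mk fun _ => trivial)⟩
  have hs : s (p e) = e := congrArg Sigma.fst hbase
  have hps : ∀ b, p (s b) = b := fun b => S.proj b trivial
  refine ⟨s, hs, ContinuousMap.ext hps, MonoidHom.ext fun c => ?_⟩
  induction c using Homotopic.Quotient.ind with | mk ω =>
  have h₁ : TransportsTo (Set.range σ : Set (Homotopic.Quotient e e)) (.mk γ)
      (.mk ((ω.map s.continuous).cast hs.symm hs.symm)) (.mk γ) :=
    transportsTo_congr hbase hbase (fun t => rfl) (S.transportsTo
      (⟨⟨fun t => ⟨ω t, trivial⟩, by fun_prop⟩, Subtype.ext ω.source, Subtype.ext ω.target⟩ :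
        Path (⟨p e, trivial⟩ : (Set.univ : Set B)) ⟨p e, trivial⟩))
  -- The marking γ of the base point lies in Λ, so it can be removed from γ · s(ω) · γ⁻¹ ∈ Λ. Hence
  -- s(ω) is itself some `σ a`, and projecting to B identifies a with the class of ω.
  have h₂ := hΛ.trans_mem (hΛ.symm_mem hγ) (hΛ.trans_mem h₁ hγ)
  simp only [Homotopic.Quotient.trans_assoc, Homotopic.Quotient.symm_trans_trans,
    Homotopic.Quotient.symm_trans, Homotopic.Quotient.trans_refl] at h₂
  obtain ⟨a, ha⟩ := h₂
  have ha' : a = .mk ω := by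
    rw [← hσ a, ha]
    exact Homotopic.Quotient.mk_eq_mk_of_forall fun t => hps (ω t)
  rw [FundamentalGroup.mapOfEq_apply, ← ha', ha, ha']
  rfl

/-- The section need not pass through e, so s_* is conjugated by a path γ from e to `s (p e)`.
Appending s(p(γ₀))⁻¹ to an arbitrary path γ₀ makes the projection of γ trivial, so that the
conjugated homomorphism still splits `p` exactly. -/
theorem exists_splitting_of_section {p : C(E, B)} {e : E} [PathConnectedSpace E] {s : C(B, E)}
    (hs : ∀ b, p (s b) = b) : ∃ σ : FundamentalGroup B (p e) →* FundamentalGroup E e,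
      ∀ c : Homotopic.Quotient (p e) (p e), Homotopic.Quotient.map (σ c) p = c := by
  let γ₀ : Homotopic.Quotient e (s (p e)) := .mk (PathConnectedSpace.somePath _ _)
  let γ : Homotopic.Quotient e (s (p e)) :=
    γ₀.trans (((γ₀.map p).symm.cast (hs _).symm rfl).map s)
  have cancel : ∀ {x y : B} (h : y = x) (c : Homotopic.Quotient x y),
      c.trans ((c.symm.cast h.symm rfl).cast h h) = (Homotopic.Quotient.refl x).cast rfl h := by
    intro x y h c
    subst h
    simp
  have conj : ∀ {x y : B} (h : y = x) (c : Homotopic.Quotient x x),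
      (((Homotopic.Quotient.refl x).cast rfl h).trans (c.cast h h)).trans
        ((Homotopic.Quotient.refl x).cast rfl h).symm = c := by
    intro x y h c
    subst h
    simp
  have hγ : γ.map p = (Homotopic.Quotient.refl (p e)).cast rfl (hs _) := by
    rw [Homotopic.Quotient.map_trans, map_map_section hs]
    exact cancel (hs _) _
  refine ⟨MonoidHom.mk' (fun c => (γ.trans (Homotopic.Quotient.map c s)).trans γ.symm)
    fun a b => ?_, fun c => ?_⟩
  · rw [FundamentalGroup.mul_def, FundamentalGroup.mul_def]
    simp [Homotopic.Quotient.map_trans]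
  · change Homotopic.Quotient.map ((γ.trans (c.map s)).trans γ.symm) p = c
    rw [Homotopic.Quotient.map_trans, Homotopic.Quotient.map_trans, Homotopic.Quotient.map_symm,
      hγ, map_map_section hs]
    exact conj (hs _) c

end Sections

theorem theorem2p1 {B E F : Type*} [TopologicalSpace B] [TopologicalSpace E] [TopologicalSpace F]
    [T2Space B] [PathConnectedSpace B] [CWComplex (Set.univ : Set B)] (hB : IsFinite2Complex B)
    (p : C(E, B)) (hp : IsFibreBundle F p) (b : B) (e : E) (he : p e = b) :
    (PathConnectedSpace E →
      ((∃ s : C(B, E), p.comp s = ContinuousMap.id B) ↔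
        (Function.Injective (FundamentalGroup.map (fibreInclusion p b) ⟨e, he⟩) ∧
          ∃ σ : FundamentalGroup B b →* FundamentalGroup E e,
            (FundamentalGroup.mapOfEq p he).comp σ = MonoidHom.id (FundamentalGroup B b)))) ∧
    (Function.Injective (FundamentalGroup.map (fibreInclusion p b) ⟨e, he⟩) →
      ∀ σ : FundamentalGroup B b →* FundamentalGroup E e,
        (FundamentalGroup.mapOfEq p he).comp σ = MonoidHom.id (FundamentalGroup B b) →
        ∃ (s : C(B, E)) (hs : s b = e),
          p.comp s = ContinuousMap.id B ∧ FundamentalGroup.mapOfEq s hs = σ) := by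
  subst he
  simp only [mapOfEq_rfl_comp_eq_id_iff, ← fibreLoopsInject_iff_injective]
  refine ⟨fun hE => ⟨?_, ?_⟩, fun hfib σ hσ => exists_section_of_splitting hB hp hfib σ hσ⟩
  · rintro ⟨s, hs⟩
    have hs' : ∀ b, p (s b) = b := fun b => DFunLike.congr_fun hs b
    exact ⟨(fibreLoopsInject_of_section hp s hs' (p e)).of_path hp
      (PathConnectedSpace.somePath _ _), exists_splitting_of_section hs'⟩
  · rintro ⟨hfib, σ, hσ⟩
    obtain ⟨s, -, hs, -⟩ := exists_section_of_splitting hB hp hfib σ hσ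
    exact ⟨s, hs⟩
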